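/- **Theorem 1.1 (LOCAL Derandomization Theorem).** $\mathsf{P}\text{-}\mathsf{LOCAL} = \mathsf{P}\text{-}\mathsf{RLOCAL}$. *Model.* The network is a graph $G=(V,E)$ with $n \ge 2$ nodes. Each node knows $n$, its own input, and its own identifier; the identifiers are pairwise distinct numbers in $\{0,\dots,n^{c}-1\}$, i.e. $O(\log n)$-bit strings, for an arbitrary fixed constant $c \ge 1$. Computation proceeds in synchronous rounds; in each round every node sends one message of unbounded size to each of its neighbours, where neighbours are addressed and recognised by their identifiers, and then performs an arbitrary local computation. In $n$-node graphs the algorithm stops after a number $T(n)$ of rounds, after which each node produces its output. In a randomized algorithm each node has in addition a private infinite sequence of independent fair random bits, independent between nodes, and the output of each node is a random variable. An algorithm is *polylogarithmic* if $T(n) \le C(\log n)^{k}$ for some constants $C,k$ and all $n \ge 2$. *Problems.* A problem specifies which graphs with node inputs are admissible instances, and which assignments of outputs (from a countable set) to the nodes are solutions of a given instance. It is *locally checkable* if there is a polylogarithmic deterministic algorithm that is given at each node the input and a candidate output, lets each node accept or reject, and is such that, on every admissible instance and for every assignment of identifiers, the candidate is a solution if and only if all nodes accept. *Classes.* $\mathsf{P}\text{-}\mathsf{LOCAL}$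 is the family of locally checkable problems for which some polylogarithmic deterministic algorithm outputs a solution on every admissible instance and for every assignment of identifiers. $\mathsf{P}\text{-}\mathsf{RLOCAL}$ is the family of locally checkable problems for which some polylogarithmic randomized algorithm outputs, on every admissible $n$-node instance and for every assignment of identifiers, a solution with probability at least $1-1/n$. *Statement.* For every $c \ge 1$ the two families are equal. In particular, every locally checkable problem that has a polylogarithmic randomized algorithm with success probability $1-1/n$ also has a polylogarithmic deterministic algorithm. -/

import Mathlib

open MeasureTheory

namespace LocalModel

/-- A synchronous message-passing algorithm of the LOCAL model, for nodes that hold inputs in `I` and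
produce outputs in `O`. Local computation and message size are unbounded, so all the components are
arbitrary functions and types. A node initially knows the number `n` of nodes, its own identifier and
its own input. In every round it sends one message to each neighbour (messages to different neighbours
may differ; neighbours are addressed by their identifiers) and updates its state from the messages
received, each of which is labelled by the identifier of its sender. After `rounds n` rounds every node
computes its output from its state. -/
structure LocalAlgorithm (I O : Type) where
  State : Type
  Msg : Type
  rounds : ℕ → ℕ
  /-- number of nodes, own identifier, own input -/
  init : ℕ → ℕ → I → State
  /-- the message sent to the neighbour with the given identifier -/
  send : State → ℕ → Msg
  /-- the new state, given the set of pairs (identifier of the sender, message) received -/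
  receive : State → Set (ℕ × Msg) → State
  output : State → O

namespace LocalAlgorithm

variable {I O : Type} {n : ℕ}

/-- The states of all nodes after `t` rounds, on the network `G` with identifiers `ident` and
inputs `x`. -/
def stateAfter (A : LocalAlgorithm I O) (G : SimpleGraph (Fin n)) (ident : Fin n → ℕ)
    (x : Fin n → I) : ℕ → Fin n → A.State
  | 0, v => A.init n (ident v) (x v)
  | t + 1, v =>
      A.receive (A.stateAfter G ident x t v)
        {p | ∃ u, G.Adj v u ∧ p = (ident u, A.send (A.stateAfter G ident x t u) (ident v))}

/-- The outputs of all nodes. -/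
def run (A : LocalAlgorithm I O) (G : SimpleGraph (Fin n)) (ident : Fin n → ℕ)
    (x : Fin n → I) (v : Fin n) : O :=
  A.output (A.stateAfter G ident x (A.rounds n) v)

/-- The number of rounds is `poly(log n)` in `n`-node graphs. -/
def IsPolylogTime (A : LocalAlgorithm I O) : Prop :=
  ∃ (C : ℝ) (k : ℕ), ∀ n : ℕ, 2 ≤ n → (A.rounds n : ℝ) ≤ C * Real.log n ^ k

end LocalAlgorithm

/-- Unique `O(log n)`-bit identifiers: pairwise distinct numbers smaller than `n ^ c`. -/
def IsIdentAssignment (c : ℕ) {n : ℕ} (ident : Fin n → ℕ) : Prop :=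
  Function.Injective ident ∧ ∀ v, ident v < n ^ c

/-- A distributed graph problem with node inputs in `In` and node outputs in `Out`: which graphs with
inputs are admissible instances (a promise, possibly `True`), and which output labellings solve a given
instance. -/
structure GraphProblem (In Out : Type) where
  IsInstance : ∀ {n : ℕ}, SimpleGraph (Fin n) → (Fin n → In) → Prop
  IsSolution : ∀ {n : ℕ}, SimpleGraph (Fin n) → (Fin n → In) → (Fin n → Out) → Prop

variable {In Out : Type}

/-- Local checkability: a `poly(log n)`-round deterministic algorithm which is given the inputs together
with a candidate output labelling and in which every node accepts or rejects, such that, whatever the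
identifiers are, the candidate is a solution if and only if all nodes accept. -/
def GraphProblem.IsLocallyCheckable (c : ℕ) (P : GraphProblem In Out) : Prop :=
  ∃ A : LocalAlgorithm (In × Out) Bool, A.IsPolylogTime ∧
    ∀ (n : ℕ) (G : SimpleGraph (Fin n)) (x : Fin n → In), 2 ≤ n → P.IsInstance G x →
      ∀ ident : Fin n → ℕ, IsIdentAssignment c ident →
        ∀ y : Fin n → Out,
          P.IsSolution G x y ↔ ∀ v, A.run G ident (fun u => (x u, y u)) v = true

/-- The deterministic algorithm `A` solves `P`. -/
def LocalAlgorithm.Solves (A : LocalAlgorithm In Out) (c : ℕ) (P : GraphProblem In Out) : Prop :=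
  ∀ (n : ℕ) (G : SimpleGraph (Fin n)) (x : Fin n → In), 2 ≤ n → P.IsInstance G x →
    ∀ ident : Fin n → ℕ, IsIdentAssignment c ident → P.IsSolution G x (A.run G ident x)

/-- The infinite sequence of random bits available to one node. -/
abbrev RandomTape : Type := ℕ → Bool

/-- The law of independent fair coin tosses. -/
noncomputable def tapeMeasure : Measure RandomTape :=
  Measure.infinitePi fun _ : ℕ => (PMF.uniformOfFintype Bool).toMeasure

/-- The joint law of the tapes of the `n` nodes, which are independent. -/
noncomputable def tapesMeasure (n : ℕ) : Measure (Fin n → RandomTape) :=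
  Measure.pi fun _ : Fin n => tapeMeasure

/-- A randomized algorithm is one in which the input of each node is supplemented by its private random
tape. It solves `P` if on every instance, whatever the identifiers are, the outputs are random variables
(with values in a countable set) that form a solution with probability at least `1 - 1 / n`. -/
def LocalAlgorithm.SolvesWithHighProbability (A : LocalAlgorithm (In × RandomTape) Out) (c : ℕ)
    (P : GraphProblem In Out) : Prop :=
  ∀ (n : ℕ) (G : SimpleGraph (Fin n)) (x : Fin n → In), 2 ≤ n → P.IsInstance G x →
    ∀ ident : Fin n → ℕ, IsIdentAssignment c ident →
      (∀ (v : Fin n) (o : Out),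
        MeasurableSet {ρ : Fin n → RandomTape | A.run G ident (fun u => (x u, ρ u)) v = o}) ∧
      1 - 1 / (n : ℝ) ≤ (tapesMeasure n).real
        {ρ : Fin n → RandomTape | P.IsSolution G x (A.run G ident fun u => (x u, ρ u))}

/-- `P-LOCAL`: the locally checkable problems solved by `poly(log n)`-round deterministic algorithms,
in networks with identifiers smaller than `n ^ c`. -/
def PLOCAL (In Out : Type) (c : ℕ) : Set (GraphProblem In Out) :=
  {P | P.IsLocallyCheckable c ∧
    ∃ A : LocalAlgorithm In Out, A.IsPolylogTime ∧ A.Solves c P}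

/-- `P-RLOCAL`: the locally checkable problems solved by `poly(log n)`-round randomized algorithms with
success probability `1 - 1 / n`, in networks with identifiers smaller than `n ^ c`. -/
def PRLOCAL (In Out : Type) (c : ℕ) : Set (GraphProblem In Out) :=
  {P | P.IsLocallyCheckable c ∧
    ∃ A : LocalAlgorithm (In × RandomTape) Out, A.IsPolylogTime ∧ A.SolvesWithHighProbability c P}

end LocalModel

/-! Only the inclusion of `PRLOCAL` in `PLOCAL` needs work: the method of conditional expectations
is run in parallel on a Rozhoň–Ghaffari clustering. Whether the checker rejects at a node depends on
the tapes within a polylogarithmic distance `s`. If fewer than one failure is expected, and tapes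
are fixed in groups without increasing this expectation, then no failure is left once all tapes are
fixed.

Success probability `1 - 1 / n` bounds the expected number of rejecting nodes only by `1`, not
strictly. So a rejecting node counts only if no neighbour with a smaller identifier rejects, and
each connected component is treated separately. Adjacent nodes never both count, hence at most `n -
1` nodes of a component do, and the expectation is at most `(n - 1) / n` (`sum_measure_lt_one`). A
rejecting node of least identifier always counts (`exists_failsOn`).

In each of about `log n` iterations, the nodes with unfixed tapes are clustered so that at least
half of them survive (`card_le_two_mul_card_alive`), distinct clusters are more than `2 * s` apart
(`labAt_eq_of_rel`), and the radius is polylogarithmic (`near_of_labAt`). No event then depends on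
two clusters, so all clusters can fix their tapes at once (`sum_condProb_fixStep_le`).

Each stage is a function of a view of polylogarithmic radius, and with unbounded messages every such
function is an algorithm (`ofLocal_run`). -/

namespace LocalModel

/-! ### Networks on identifiers and their views -/

/-- A network whose vertices are identifiers. -/
structure Net (I : Type) where
  node : Set ℕ
  adj : ℕ → ℕ → Prop
  symm : ∀ {a b}, adj a b → adj b a
  inp : ℕ → I

namespace Net

variable {I : Type}

/-- `N.Near r a b`: the distance between `a` and `b` is at most `r`. -/
def Near (N : Net I) : ℕ → ℕ → ℕ → Prop
  | 0, a, b => a = b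
  | r + 1, a, b => N.Near r a b ∨ ∃ w, N.adj a w ∧ N.Near r w b

/-- `N.Agree M r a`: the views of radius `r` of the node with identifier `a` coincide. -/
def Agree (N M : Net I) : ℕ → ℕ → Prop
  | 0, a => (a ∈ N.node ↔ a ∈ M.node) ∧ N.inp a = M.inp a
  | r + 1, a => N.Agree M r a ∧ (∀ b, N.adj a b ↔ M.adj a b) ∧ ∀ b, N.adj a b → N.Agree M r b

variable {N M : Net I}

theorem Near.refl (N : Net I) (r a : ℕ) : N.Near r a a := by
  induction r with
  | zero => rfl
  | succ r ih => exact Or.inl ih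

theorem Near.trans {r s a b c : ℕ} (h : N.Near r a b) (h' : N.Near s b c) :
    N.Near (r + s) a c := by
  induction r generalizing a with
  | zero => cases h; simpa using h'
  | succ r ih =>
    rw [Nat.succ_add]
    rcases h with h | ⟨w, hw, h⟩
    · exact Or.inl (ih h)
    · exact Or.inr ⟨w, hw, ih h⟩

theorem Near.mono {r s a b : ℕ} (h : N.Near r a b) (hrs : r ≤ s) : N.Near s a b := by
  obtain ⟨d, rfl⟩ := Nat.exists_eq_add_of_le hrs
  exact h.trans (Near.refl N d b)

theorem Near.of_adj {a b : ℕ} (h : N.adj a b) : N.Near 1 a b := Or.inr ⟨b, h, rfl⟩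

theorem Near.symm {r a b : ℕ} (h : N.Near r a b) : N.Near r b a := by
  induction r generalizing a with
  | zero => exact Eq.symm h
  | succ r ih =>
    rcases h with h | ⟨w, hw, h⟩
    · exact Or.inl (ih h)
    · exact (ih h).trans (Near.of_adj (N.symm hw))

/-- Each edge of a path uses up one level of the recursion in `Agree`. All later locality bounds
rest on this. -/
theorem Agree.near {r s a b : ℕ} (h : N.Agree M (r + s) a) (hn : N.Near r a b) :
    M.Near r a b ∧ N.Agree M s b := by
  induction r generalizing a with
  | zero => cases hn; exact ⟨rfl, by simpa using h⟩
  | succ r ih =>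
    rw [Nat.succ_add] at h
    rcases hn with hn | ⟨w, hw, hn⟩
    · exact ⟨Or.inl (ih h.1 hn).1, (ih h.1 hn).2⟩
    · exact ⟨Or.inr ⟨w, (h.2.1 w).1 hw, (ih (h.2.2 w hw) hn).1⟩, (ih (h.2.2 w hw) hn).2⟩

theorem Agree.mono {r s a : ℕ} (h : N.Agree M s a) (hrs : r ≤ s) : N.Agree M r a := by
  obtain ⟨d, rfl⟩ := Nat.exists_eq_add_of_le' hrs
  exact (h.near (Near.refl N d a)).2

theorem Agree.symm {r a : ℕ} (h : N.Agree M r a) : M.Agree N r a := by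
  induction r generalizing a with
  | zero => exact ⟨h.1.symm, h.2.symm⟩
  | succ r ih =>
    exact ⟨ih h.1, fun b => (h.2.1 b).symm, fun b hb => ih (h.2.2 b ((h.2.1 b).2 hb))⟩

theorem Agree.refl (N : Net I) (r a : ℕ) : N.Agree N r a := by
  induction r generalizing a with
  | zero => exact ⟨Iff.rfl, rfl⟩
  | succ r ih => exact ⟨ih a, fun _ => Iff.rfl, fun b _ => ih b⟩

theorem Agree.base {r a : ℕ} (h : N.Agree M r a) :
    (a ∈ N.node ↔ a ∈ M.node) ∧ N.inp a = M.inp a := h.mono (Nat.zero_le r)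

/-- `Same N M r σ τ a`: the views of radius `r` of `a` coincide, and so do the labellings `σ` of `N` and
`τ` of `M` in these views. -/
def Same {X : Type} (N M : Net I) (r : ℕ) (σ τ : ℕ → X) (a : ℕ) : Prop :=
  N.Agree M r a ∧ ∀ b, N.Near r a b → σ b = τ b

theorem Same.symm {X : Type} {r a : ℕ} {σ τ : ℕ → X} (h : Same N M r σ τ a) :
    Same M N r τ σ a :=
  ⟨h.1.symm, fun b hb => (h.2 b (h.1.symm.near (s := 0) hb).1).symm⟩

theorem Same.near {X : Type} {r s a b : ℕ} {σ τ : ℕ → X} (h : Same N M (r + s) σ τ a)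
    (hb : N.Near r a b) : Same N M s σ τ b :=
  ⟨(h.1.near hb).2, fun c hc => h.2 c (hb.trans hc)⟩

theorem Same.mono {X : Type} {r s a : ℕ} {σ τ : ℕ → X} (h : Same N M s σ τ a) (hrs : r ≤ s) :
    Same N M r σ τ a :=
  ⟨h.1.mono hrs, fun b hb => h.2 b (hb.mono hrs)⟩

/-- If `F` is `r`-local then labels computed by `F` agree on the smaller views. -/
theorem Same.map {X Y : Type} {r s a : ℕ} {σ τ : ℕ → X} {F G : ℕ → Y}
    (h : Same N M (r + s) σ τ a) (hF : ∀ b, Same N M s σ τ b → F b = G b) :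
    Same N M r F G a :=
  ⟨h.1.mono (Nat.le_add_right r s), fun b hb => hF b (h.near hb)⟩

/-- The network on identifiers given by a network on `Fin n` and an assignment of identifiers. -/
noncomputable def ofGraph [Nonempty I] {n : ℕ} (G : SimpleGraph (Fin n)) (ident : Fin n → ℕ)
    (x : Fin n → I) : Net I where
  node := Set.range ident
  adj a b := ∃ u v, G.Adj u v ∧ ident u = a ∧ ident v = b
  symm := by rintro a b ⟨u, v, h, ha, hb⟩; exact ⟨v, u, h.symm, hb, ha⟩
  inp := Function.extend ident x fun _ => Classical.arbitrary I

end Net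

/-! ### Algorithms as local functions of views, and conversely -/

namespace LocalAlgorithm

variable {I J O : Type}

/-- The states after `t` rounds in a network on identifiers with inputs `f`. -/
def netState (A : LocalAlgorithm J O) (n : ℕ) (N : Net I) (f : ℕ → J) : ℕ → ℕ → A.State
  | 0, a => A.init n a (f a)
  | t + 1, a =>
      A.receive (A.netState n N f t a)
        {p | ∃ b, N.adj a b ∧ p = (b, A.send (A.netState n N f t b) a)}

/-- The outputs in a network on identifiers with inputs `f`. -/
def netRun (A : LocalAlgorithm J O) (n : ℕ) (N : Net I) (f : ℕ → J) (a : ℕ) : O :=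
  A.output (A.netState n N f (A.rounds n) a)

/-- Information travels one edge per round. -/
theorem netState_congr (A : LocalAlgorithm J O) (n : ℕ) {N M : Net I} {f g : ℕ → J} {t a : ℕ}
    (h : Net.Same N M t f g a) : A.netState n N f t a = A.netState n M g t a := by
  induction t generalizing a with
  | zero => simp only [netState, h.2 a rfl]
  | succ t ih =>
    simp only [netState]
    rw [ih (h.mono (Nat.le_succ t))]
    congr 1
    ext p
    have key : ∀ b, N.adj a b → A.netState n N f t b = A.netState n M g t b := fun b hb =>
      ih (Net.Same.near (r := 1) (by rwa [Nat.add_comm]) (Net.Near.of_adj hb))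
    constructor
    · rintro ⟨b, hb, rfl⟩
      exact ⟨b, (h.1.2.1 b).1 hb, by rw [key b hb]⟩
    · rintro ⟨b, hb, rfl⟩
      exact ⟨b, (h.1.2.1 b).2 hb, by rw [key b ((h.1.2.1 b).2 hb)]⟩

theorem netRun_congr (A : LocalAlgorithm J O) (n : ℕ) {N M : Net I} {f g : ℕ → J} {a : ℕ}
    (h : Net.Same N M (A.rounds n) f g a) : A.netRun n N f a = A.netRun n M g a := by
  rw [netRun, netRun, A.netState_congr n h]

theorem netRun_ofGraph [Nonempty I] (A : LocalAlgorithm J O) {n : ℕ} (G : SimpleGraph (Fin n))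
    {ident : Fin n → ℕ} (hid : Function.Injective ident) (x : Fin n → I) (f : ℕ → J) (v : Fin n) :
    A.netRun n (Net.ofGraph G ident x) f (ident v) = A.run G ident (fun u => f (ident u)) v := by
  suffices h : ∀ t v, A.netState n (Net.ofGraph G ident x) f t (ident v) =
      A.stateAfter G ident (fun u => f (ident u)) t v by
    rw [netRun, run, h]
  intro t
  induction t with
  | zero => intro v; rfl
  | succ t ih =>
    intro v
    simp only [netState, stateAfter, ih]
    congr 1
    ext p
    constructor
    · rintro ⟨b, ⟨u, w, huw, hu, rfl⟩, rfl⟩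
      cases hid hu
      exact ⟨w, huw, by rw [ih]⟩
    · rintro ⟨u, hu, rfl⟩
      exact ⟨ident u, ⟨v, u, hu, rfl, rfl⟩, by rw [ih]⟩

/-- The algorithm that collects for `r n` rounds all that there is to know, and then evaluates `F n` on
some network that is consistent with what it has seen. -/
noncomputable def ofLocal [Nonempty (Net I)] (r : ℕ → ℕ) (F : ℕ → Net I → ℕ → O) :
    LocalAlgorithm I O where
  State := ℕ × ℕ × Set (Net I)
  Msg := Set (Net I)
  rounds := r
  init n a x := (n, a, {N | a ∈ N.node ∧ N.inp a = x})
  send s _ := s.2.2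
  receive s m := (s.1, s.2.1, {N | N ∈ s.2.2 ∧ (∀ b, N.adj s.2.1 b ↔ ∃ q, (b, q) ∈ m) ∧
    ∀ b q, (b, q) ∈ m → N ∈ q})
  output s := F s.1 (Classical.epsilon fun N => N ∈ s.2.2) s.2.1

/-- Intersecting with the sets received from the neighbours reproduces the recursion that defines
`Agree`. -/
theorem ofLocal_stateAfter [Nonempty I] [Nonempty (Net I)] (r : ℕ → ℕ) (F : ℕ → Net I → ℕ → O)
    {n : ℕ} (G : SimpleGraph (Fin n)) {ident : Fin n → ℕ} (hid : Function.Injective ident)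
    (x : Fin n → I) (t : ℕ) (v : Fin n) :
    (ofLocal r F).stateAfter G ident x t v =
      (n, ident v, {N | N.Agree (Net.ofGraph G ident x) t (ident v)}) := by
  induction t generalizing v with
  | zero =>
    simp only [stateAfter, ofLocal, Net.Agree]
    have h1 : ident v ∈ (Net.ofGraph G ident x).node := ⟨v, rfl⟩
    have h2 : (Net.ofGraph G ident x).inp (ident v) = x v :=
      hid.extend_apply x (fun _ => Classical.arbitrary I) v
    simp [h1, h2]
  | succ t ih =>
    simp only [stateAfter, ih]
    simp only [ofLocal, Prod.mk.injEq, true_and]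
    ext N
    simp only [Set.mem_ofPred_eq, Net.Agree]
    have hadj : ∀ b, (Net.ofGraph G ident x).adj (ident v) b ↔ ∃ u, G.Adj v u ∧ b = ident u := by
      intro b
      constructor
      · rintro ⟨u, w, h, hu, rfl⟩
        cases hid hu
        exact ⟨w, h, rfl⟩
      · rintro ⟨u, h, rfl⟩
        exact ⟨v, u, h, rfl, rfl⟩
    refine and_congr_right fun _ => ?_
    -- The sender labels on the messages are exactly the identifiers of the neighbours.
    have h1 : (∀ b, N.adj (ident v) b ↔ ∃ (q : Set (Net I)) (u : _), G.Adj v u ∧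
        (b, q) = (ident u, {N | N.Agree (Net.ofGraph G ident x) t (ident u)})) ↔
        ∀ b, N.adj (ident v) b ↔ (Net.ofGraph G ident x).adj (ident v) b := by
      refine forall_congr' fun b => iff_congr Iff.rfl ?_
      rw [hadj]
      constructor
      · rintro ⟨q, u, hu, h⟩
        exact ⟨u, hu, (Prod.ext_iff.1 h).1⟩
      · rintro ⟨u, hu, rfl⟩
        exact ⟨_, u, hu, rfl⟩
    rw [← h1]
    refine and_congr_right fun h => ?_
    rw [h1] at h
    constructor
    · intro h2 b hb
      obtain ⟨u, hu, rfl⟩ := (hadj b).1 ((h b).1 hb)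
      exact h2 _ _ ⟨u, hu, rfl⟩
    · rintro h2 b q ⟨u, hu, hp⟩
      obtain ⟨rfl, rfl⟩ := Prod.ext_iff.1 hp
      exact h2 _ ((h _).2 ((hadj _).2 ⟨u, hu, rfl⟩))

/-- The true network is among the consistent ones, and `F n` has the same value on all of them, so
the arbitrary choice is harmless. -/
theorem ofLocal_run [Nonempty I] [Nonempty (Net I)] (r : ℕ → ℕ) (F : ℕ → Net I → ℕ → O)
    {n : ℕ} (hF : ∀ N M a, Net.Agree N M (r n) a → F n N a = F n M a)
    (G : SimpleGraph (Fin n)) {ident : Fin n → ℕ} (hid : Function.Injective ident)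
    (x : Fin n → I) (v : Fin n) :
    (ofLocal r F).run G ident x v = F n (Net.ofGraph G ident x) (ident v) := by
  rw [run, ofLocal_stateAfter r F G hid]
  have h : ∃ N, N ∈ {N : Net I | N.Agree (Net.ofGraph G ident x) (r n) (ident v)} :=
    ⟨_, Net.Agree.refl _ _ _⟩
  exact hF _ _ _ (Classical.epsilon_spec h)

end LocalAlgorithm

/-! ### The Rozhoň–Ghaffari clustering: separation and number of survivors -/

namespace Clustering

variable (R : ℕ → ℕ → Prop)

/-- The labels with `i`-th bit `0` that occur next to `v`. -/
def candidates (i : ℕ) (lab : ℕ → Option ℕ) (v : ℕ) : Set ℕ :=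
  {l | l.testBit i = false ∧ ∃ u, R v u ∧ lab u = some l}

/-- The label of `v` has `i`-th bit `1`. -/
def IsRed (i : ℕ) (lab : ℕ → Option ℕ) (v : ℕ) : Prop := ∃ m, lab v = some m ∧ m.testBit i = true

open Classical in
/-- The cluster that `v` asks to join. -/
noncomputable def request (i : ℕ) (lab : ℕ → Option ℕ) (v : ℕ) : Option ℕ :=
  if IsRed i lab v ∧ (candidates R i lab v).Nonempty then some (sInf (candidates R i lab v)) else none

/-- The cluster `l` has enough requests to grow. -/
def Accepts (b i : ℕ) (lab : ℕ → Option ℕ) (l : ℕ) : Prop :=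
  {u | lab u = some l}.ncard ≤ 2 * b * {u | request R i lab u = some l}.ncard

open Classical in
/-- One step of the Rozhoň–Ghaffari clustering: requests are granted, or else those who ask are removed. -/
noncomputable def step (b i : ℕ) (lab : ℕ → Option ℕ) (v : ℕ) : Option ℕ :=
  match request R i lab v with
  | none => lab v
  | some l => if Accepts R b i lab l then some l else none

open Classical in
/-- The labels after `s` steps, `T` for each bit, when the nodes in `S` are to be clustered. -/
noncomputable def labAt (b T : ℕ) (S : Set ℕ) : ℕ → ℕ → Option ℕ
  | 0, v => if v ∈ S then some v else none
  | s + 1, v => step R b (s / T) (labAt b T S s) v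

/-- Some node with `i`-th bit `1` is next to the cluster `l`, whose `i`-th bit is `0`. -/
def Active (i : ℕ) (lab : ℕ → Option ℕ) (l : ℕ) : Prop :=
  l.testBit i = false ∧ ∃ u v, R v u ∧ lab u = some l ∧ IsRed i lab v

/-- The nodes that are still labelled. -/
def alive (lab : ℕ → Option ℕ) : Set ℕ := {v | lab v ≠ none}

/-- The nodes in clusters that will not grow any more while bit `i` is considered. -/
def settled (i : ℕ) (lab : ℕ → Option ℕ) : Set ℕ :=
  {v | ∃ l, lab v = some l ∧ l.testBit i = false ∧ ¬ Active R i lab l}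

variable {R} {b i : ℕ} {lab : ℕ → Option ℕ}

theorem request_eq_some {v l : ℕ} (h : request R i lab v = some l) :
    IsRed i lab v ∧ l.testBit i = false ∧ ∃ u, R v u ∧ lab u = some l := by
  unfold request at h
  split_ifs at h with hc
  cases h
  exact ⟨hc.1, Nat.sInf_mem hc.2⟩

theorem request_eq_none_of_blue {v l : ℕ} (h : lab v = some l) (hl : l.testBit i = false) :
    request R i lab v = none := by
  unfold request
  rw [if_neg]
  rintro ⟨⟨m, hm, hm'⟩, -⟩
  rw [h] at hm
  cases hm
  simp [hl] at hm'

theorem step_of_request_none {v : ℕ} (h : request R i lab v = none) :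
    step R b i lab v = lab v := by simp [step, h]

theorem step_of_accepts {v l : ℕ} (h : request R i lab v = some l) (hl : Accepts R b i lab l) :
    step R b i lab v = some l := by simp [step, h, hl]

theorem step_of_not_accepts {v l : ℕ} (h : request R i lab v = some l)
    (hl : ¬ Accepts R b i lab l) : step R b i lab v = none := by simp [step, h, hl]

theorem step_blue {v l : ℕ} (h : lab v = some l) (hl : l.testBit i = false) :
    step R b i lab v = some l := by
  rw [step_of_request_none (request_eq_none_of_blue h hl), h]

theorem step_eq_some {v l : ℕ} (h : step R b i lab v = some l) :
    (request R i lab v = none ∧ lab v = some l) ∨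
      (request R i lab v = some l ∧ Accepts R b i lab l) := by
  cases hr : request R i lab v with
  | none => rw [step_of_request_none hr] at h; exact Or.inl ⟨rfl, h⟩
  | some m =>
    by_cases ha : Accepts R b i lab m
    · rw [step_of_accepts hr ha] at h; cases h; exact Or.inr ⟨rfl, ha⟩
    · rw [step_of_not_accepts hr ha] at h; cases h

theorem exists_of_step_eq_some {v l : ℕ} (h : step R b i lab v = some l) :
    ∃ m, lab v = some m ∧ (m = l ∨ ∃ u, R v u ∧ lab u = some l) := by
  rcases step_eq_some h with ⟨-, h⟩ | ⟨h, -⟩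
  · exact ⟨l, h, Or.inl rfl⟩
  · obtain ⟨⟨m, hm, -⟩, -, hu⟩ := request_eq_some h
    exact ⟨m, hm, Or.inr hu⟩

theorem alive_step_subset : alive (step R b i lab) ⊆ alive lab := by
  intro v hv
  obtain ⟨l, hl⟩ := Option.ne_none_iff_exists'.1 hv
  obtain ⟨m, hm, -⟩ := exists_of_step_eq_some hl
  simp [alive, hm]

/-- A node that is red after the step made no request, so it had no blue neighbour before. Its blue
neighbour in `l` has therefore just joined, which means that `l` accepted and was itself next to a
red node. -/
theorem active_of_active_step {l : ℕ} (h : Active R i (step R b i lab) l) :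
    Active R i lab l ∧ Accepts R b i lab l := by
  obtain ⟨hl, u, v, hvu, hu, m, hm, hmi⟩ := h
  have hv : request R i lab v = none ∧ lab v = some m := by
    rcases step_eq_some hm with h | ⟨h, -⟩
    · exact h
    · have := (request_eq_some h).2.1
      simp [hmi] at this
  rcases step_eq_some hu with ⟨-, h⟩ | ⟨h, ha⟩
  · exfalso
    have hr := hv.1
    unfold request at hr
    rw [if_pos ⟨⟨m, hv.2, hmi⟩, ⟨l, hl, u, hvu, h⟩⟩] at hr
    cases hr
  · obtain ⟨hred, -, w, hw, hwl⟩ := request_eq_some h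
    exact ⟨⟨hl, w, u, hw, hwl, hred⟩, ha⟩

theorem finite_label (hfin : (alive lab).Finite) (l : ℕ) : {u | lab u = some l}.Finite :=
  hfin.subset fun u hu => by
    have hu : lab u = some l := hu
    simp [alive, hu]

theorem finite_request (hfin : (alive lab).Finite) (l : ℕ) :
    {u | request R i lab u = some l}.Finite :=
  hfin.subset fun u hu => by
    obtain ⟨⟨m, hm, -⟩, -⟩ := request_eq_some hu
    simp [alive, hm]

/-- Blue members stay and all requesters join, so an accepting cluster grows by a factor of at least
`1 + 1 / (2 * b)`. -/
theorem card_le_card_step (hfin : (alive lab).Finite) {l : ℕ} (hl : l.testBit i = false)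
    (ha : Accepts R b i lab l) :
    (2 * b + 1) * {u | lab u = some l}.ncard ≤ 2 * b * {u | step R b i lab u = some l}.ncard := by
  have hd : Disjoint {u | lab u = some l} {u | request R i lab u = some l} := by
    rw [Set.disjoint_left]
    intro u hu hu'
    have := request_eq_none_of_blue (R := R) hu hl
    simp [show request R i lab u = some l from hu'] at this
  have hsub : {u | lab u = some l} ∪ {u | request R i lab u = some l} ⊆
      {u | step R b i lab u = some l} := by
    rintro u (hu | hu)
    · exact step_blue hu hl
    · exact step_of_accepts hu ha
  have h := Set.ncard_le_ncard hsub (finite_label (hfin.subset alive_step_subset) l)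
  rw [Set.ncard_union_eq hd (finite_label hfin l) (finite_request hfin l)] at h
  unfold Accepts at ha
  nlinarith

theorem mul_card_le_card_of_fiber {α β : Type*} [DecidableEq β] {K J : Finset α} {f g : α → β}
    {c : ℕ} (h : ∀ y ∈ K.image f, c * (K.filter (f · = y)).card ≤ (J.filter (g · = y)).card) :
    c * K.card ≤ J.card := by
  rw [Finset.card_eq_sum_card_image f K, Finset.mul_sum]
  refine (Finset.sum_le_sum h).trans ?_
  rw [Finset.sum_card_fiberwise_eq_card_filter]
  exact Finset.card_filter_le _ _

/-- Counted cluster by cluster: a refusing cluster has more than `2 * b` members for each node it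
removes. -/
theorem card_killed_le (hfin : (alive lab).Finite) :
    2 * b * {v | ∃ l, request R i lab v = some l ∧ ¬ Accepts R b i lab l}.ncard ≤
      {v | ∃ l, lab v = some l ∧ ¬ Accepts R b i lab l ∧ ∃ u, request R i lab u = some l}.ncard := by
  have hK : {v | ∃ l, request R i lab v = some l ∧ ¬ Accepts R b i lab l}.Finite :=
    hfin.subset fun v ⟨l, hl, _⟩ => by
      obtain ⟨⟨m, hm, -⟩, -⟩ := request_eq_some hl
      simp [alive, hm]
  have hJ : {v | ∃ l, lab v = some l ∧ ¬ Accepts R b i lab l ∧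
      ∃ u, request R i lab u = some l}.Finite :=
    hfin.subset fun v ⟨l, hl, _⟩ => by simp [alive, hl]
  rw [Set.ncard_eq_toFinset_card _ hK, Set.ncard_eq_toFinset_card _ hJ]
  refine mul_card_le_card_of_fiber (f := request R i lab) (g := lab) fun y hy => ?_
  obtain ⟨v, hv, rfl⟩ := Finset.mem_image.1 hy
  obtain ⟨l, hl, hna⟩ := (Set.Finite.mem_toFinset hK).1 hv
  have h1 : (↑(hK.toFinset.filter (request R i lab · = request R i lab v)) : Set ℕ) =
      {u | request R i lab u = some l} := by
    ext u
    simp only [Finset.coe_filter, Set.Finite.mem_toFinset, Set.mem_ofPred_eq, hl]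
    exact ⟨fun h => h.2, fun h => ⟨⟨l, h, hna⟩, h⟩⟩
  have h2 : (↑(hJ.toFinset.filter (lab · = request R i lab v)) : Set ℕ) =
      {u | lab u = some l} := by
    ext u
    simp only [Finset.coe_filter, Set.Finite.mem_toFinset, Set.mem_ofPred_eq, hl]
    exact ⟨fun h => h.2, fun h => ⟨⟨l, h, hna, v, hl⟩, h⟩⟩
  rw [← Set.ncard_coe_finset, ← Set.ncard_coe_finset, h1, h2]
  unfold Accepts at hna
  omega

/-- Potential argument: a refusing cluster becomes settled, settled clusters stay settled, and the
newly settled nodes pay for the removed ones. -/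
theorem card_alive_step (hfin : (alive lab).Finite) :
    2 * b * (alive lab).ncard + (settled R i lab).ncard ≤
      2 * b * (alive (step R b i lab)).ncard + (settled R i (step R b i lab)).ncard := by
  set K := {v | ∃ l, request R i lab v = some l ∧ ¬ Accepts R b i lab l} with hKdef
  set J := {v | ∃ l, lab v = some l ∧ ¬ Accepts R b i lab l ∧ ∃ u, request R i lab u = some l}
    with hJdef
  have hKJ : 2 * b * K.ncard ≤ J.ncard := card_killed_le hfin
  have hfin' : (alive (step R b i lab)).Finite := hfin.subset alive_step_subset
  have hset : ∀ lab' : ℕ → Option ℕ, settled R i lab' ⊆ alive lab' := fun lab' v ⟨l, hl, _⟩ => by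
    simp [alive, hl]
  have hKfin : K ⊆ alive lab := fun v ⟨l, hl, _⟩ => by
    obtain ⟨⟨m, hm, -⟩, -⟩ := request_eq_some hl
    simp [alive, hm]
  have hJfin : J ⊆ alive lab := fun v ⟨l, hl, _⟩ => by simp [alive, hl]
  have h1 : (alive lab).ncard ≤ (alive (step R b i lab)).ncard + K.ncard := by
    refine (Set.ncard_le_ncard ?_ (hfin'.union (hfin.subset hKfin))).trans (Set.ncard_union_le _ _)
    intro v hv
    cases hr : request R i lab v with
    | none =>
      refine Or.inl ?_
      change step R b i lab v ≠ none
      rw [step_of_request_none hr]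
      exact hv
    | some l =>
      by_cases ha : Accepts R b i lab l
      · refine Or.inl ?_
        change step R b i lab v ≠ none
        rw [step_of_accepts hr ha]
        simp
      · exact Or.inr ⟨l, hr, ha⟩
  have hd : Disjoint (settled R i lab) J := by
    rw [Set.disjoint_left]
    rintro v ⟨l, hl, hli, hna⟩ ⟨m, hm, -, u, hu⟩
    rw [hl] at hm
    cases hm
    obtain ⟨hred, -, w, hw, hwl⟩ := request_eq_some hu
    exact hna ⟨hli, w, u, hw, hwl, hred⟩
  have h2 : settled R i lab ∪ J ⊆ settled R i (step R b i lab) := by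
    rintro v (⟨l, hl, hli, hna⟩ | ⟨l, hl, hna, u, hu⟩)
    · exact ⟨l, step_blue hl hli, hli, fun h => hna (active_of_active_step h).1⟩
    · have hli := (request_eq_some hu).2.1
      exact ⟨l, step_blue hl hli, hli, fun h => hna (active_of_active_step h).2⟩
  have h3 := Set.ncard_le_ncard h2 (hfin'.subset (hset _))
  rw [Set.ncard_union_eq hd (hfin.subset (hset _)) (hfin.subset hJfin)] at h3
  nlinarith

theorem alive_iterate_subset (t : ℕ) : alive ((step R b i)^[t] lab) ⊆ alive lab := by
  induction t with
  | zero => exact subset_rfl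
  | succ t ih => rw [Function.iterate_succ_apply']; exact alive_step_subset.trans ih

theorem card_alive_iterate (hfin : (alive lab).Finite) (t : ℕ) :
    2 * b * (alive lab).ncard + (settled R i lab).ncard ≤
      2 * b * (alive ((step R b i)^[t] lab)).ncard +
        (settled R i ((step R b i)^[t] lab)).ncard := by
  induction t with
  | zero => exact le_rfl
  | succ t ih =>
    rw [Function.iterate_succ_apply']
    exact ih.trans (card_alive_step (hfin.subset (alive_iterate_subset t)))

/-- Settled nodes are alive, so the potential bounds the loss in one phase by a fraction `1 / (2 *
b)`. -/
theorem card_alive_phase (hfin : (alive lab).Finite) (t : ℕ) :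
    2 * b * (alive lab).ncard ≤ 2 * b * (alive ((step R b i)^[t] lab)).ncard +
        (alive lab).ncard := by
  have h := card_alive_iterate (R := R) (b := b) (i := i) hfin t
  have h' : (settled R i ((step R b i)^[t] lab)).ncard ≤ (alive lab).ncard := by
    refine Set.ncard_le_ncard (subset_trans ?_ (alive_iterate_subset (R := R) (b := b) (i := i) t)) hfin
    rintro v ⟨l, hl, -⟩
    simp [alive, hl]
  omega

/-- A cluster that is still active has accepted, and thus grown, in every earlier step of the phase.
-/
theorem pow_le_of_active (hfin : (alive lab).Finite) {t l : ℕ}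
    (h : Active R i ((step R b i)^[t] lab) l) :
    (2 * b + 1) ^ t ≤ (2 * b) ^ t * {u | (step R b i)^[t] lab u = some l}.ncard := by
  induction t with
  | zero =>
    obtain ⟨-, u, v, -, hu, -⟩ := h
    have : 0 < {u | (step R b i)^[0] lab u = some l}.ncard :=
      (Set.ncard_pos (finite_label hfin l)).2 ⟨u, hu⟩
    simpa using Nat.succ_le_of_lt this
  | succ t ih =>
    rw [Function.iterate_succ_apply'] at h ⊢
    have hfin' := hfin.subset (alive_iterate_subset (R := R) (b := b) (i := i) t)
    obtain ⟨h1, h2⟩ := active_of_active_step h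
    have h3 := card_le_card_step hfin' h.1 h2
    calc (2 * b + 1) ^ (t + 1) = (2 * b + 1) * (2 * b + 1) ^ t := by ring
      _ ≤ (2 * b + 1) * ((2 * b) ^ t * {u | (step R b i)^[t] lab u = some l}.ncard) :=
          Nat.mul_le_mul_left _ (ih h1)
      _ = (2 * b) ^ t * ((2 * b + 1) * {u | (step R b i)^[t] lab u = some l}.ncard) := by ring
      _ ≤ (2 * b) ^ t * _ := Nat.mul_le_mul_left _ h3
      _ = _ := by ring

theorem not_active_of_lt (hfin : (alive lab).Finite) {t l : ℕ}
    (ht : (2 * b) ^ t * (alive lab).ncard < (2 * b + 1) ^ t) :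
    ¬ Active R i ((step R b i)^[t] lab) l := by
  intro h
  have h1 := pow_le_of_active hfin h
  have h2 : {u | (step R b i)^[t] lab u = some l}.ncard ≤ (alive lab).ncard := by
    refine Set.ncard_le_ncard (subset_trans ?_ (alive_iterate_subset (R := R) (b := b) (i := i) t)) hfin
    intro u hu
    have hu : (step R b i)^[t] lab u = some l := hu
    simp [alive, hu]
  have := Nat.mul_le_mul_left ((2 * b) ^ t) h2
  omega

/-- Neighbouring labels agree in the first `i` bits. -/
def Separated (R : ℕ → ℕ → Prop) (i : ℕ) (lab : ℕ → Option ℕ) : Prop :=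
  ∀ u v l m, R u v → lab u = some l → lab v = some m → ∀ j < i, l.testBit j = m.testBit j

/-- A node only adopts labels of its neighbours, so the first `i` bits of its label never change. -/
theorem Separated.step (h : Separated R i lab) : Separated R i (step R b i lab) := by
  have key : ∀ v l, Clustering.step R b i lab v = some l →
      ∃ m, lab v = some m ∧ ∀ j < i, m.testBit j = l.testBit j := by
    intro v l hv
    obtain ⟨m, hm, rfl | ⟨u, hu, hul⟩⟩ := exists_of_step_eq_some hv
    · exact ⟨m, hm, fun _ _ => rfl⟩
    · exact ⟨m, hm, h v u m l hu hm hul⟩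
  intro u v l m huv hu hv j hj
  obtain ⟨l', hl', hl⟩ := key u l hu
  obtain ⟨m', hm', hm⟩ := key v m hv
  rw [← hl j hj, ← hm j hj]
  exact h u v l' m' huv hl' hm' j hj

/-- If adjacent labels differed in bit `i`, the one with bit `0` would be active. -/
theorem Separated.succ (hR : ∀ u v, R u v → R v u) (h : Separated R i lab)
    (ha : ∀ l, ¬ Active R i lab l) : Separated R (i + 1) lab := by
  intro u v l m huv hu hv j hj
  rcases Nat.lt_succ_iff_lt_or_eq.1 hj with hj | rfl
  · exact h u v l m huv hu hv j hj
  · cases hl : l.testBit j <;> cases hm : m.testBit j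
    · rfl
    · exact absurd ⟨hl, u, v, hR _ _ huv, hu, m, hv, hm⟩ (ha l)
    · exact absurd ⟨hm, v, u, huv, hv, l, hu, hl⟩ (ha m)
    · rfl

variable {T : ℕ} {S : Set ℕ}

theorem labAt_mul_add (i : ℕ) {t : ℕ} (ht : t ≤ T) :
    labAt R b T S (i * T + t) = (step R b i)^[t] (labAt R b T S (i * T)) := by
  induction t with
  | zero => rfl
  | succ t ih =>
    rw [Function.iterate_succ_apply', ← ih (Nat.le_of_succ_le ht)]
    funext v
    change step R b ((i * T + t) / T) (labAt R b T S (i * T + t)) v = _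
    have hdiv : (i * T + t) / T = i := by
      rw [Nat.add_comm, Nat.add_mul_div_right _ _ (by omega), Nat.div_eq_of_lt (by omega),
        Nat.zero_add]
    rw [hdiv]

theorem labAt_succ_mul (i : ℕ) :
    labAt R b T S ((i + 1) * T) = (step R b i)^[T] (labAt R b T S (i * T)) := by
  rw [Nat.succ_mul]
  exact labAt_mul_add i le_rfl

theorem alive_labAt_zero : alive (labAt R b T S 0) = S := by
  ext v
  simp [alive, labAt]

theorem alive_labAt_subset (s : ℕ) : alive (labAt R b T S s) ⊆ S := by
  induction s with
  | zero => exact alive_labAt_zero.subset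
  | succ s ih => exact (alive_step_subset (R := R) (b := b)).trans ih

theorem mem_of_labAt {s v l : ℕ} (h : labAt R b T S s v = some l) : l ∈ S := by
  induction s generalizing v with
  | zero =>
    simp only [labAt] at h
    split_ifs at h with hv
    cases h
    exact hv
  | succ s ih =>
    obtain ⟨m, hm, rfl | ⟨u, -, hu⟩⟩ := exists_of_step_eq_some h
    · exact ih hm
    · exact ih hu

/-- Each of the `b` phases removes at most `S.ncard / (2 * b)` nodes. -/
theorem card_le_two_mul_card_alive (hS : S.Finite) (hb : 0 < b) :
    S.ncard ≤ 2 * (alive (labAt R b T S (b * T))).ncard := by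
  have key : ∀ i, 2 * b * S.ncard ≤
      2 * b * (alive (labAt R b T S (i * T))).ncard + i * S.ncard := by
    intro i
    induction i with
    | zero => simp [alive_labAt_zero]
    | succ i ih =>
      have hsub := alive_labAt_subset (R := R) (b := b) (T := T) (S := S) (i * T)
      have h1 := card_alive_phase (R := R) (b := b) (i := i) (hS.subset hsub) T
      have h2 := Set.ncard_le_ncard hsub hS
      rw [labAt_succ_mul, Nat.succ_mul i]
      omega
  have h := key b
  nlinarith

/-- By `hT` a cluster active for `T` steps would outgrow `S`, so each phase ends without active
clusters and separates one more bit. -/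
theorem labAt_eq_of_rel (hR : ∀ u v, R u v → R v u) (hS : S.Finite)
    (hT : (2 * b) ^ T * S.ncard < (2 * b + 1) ^ T) (hb : ∀ v ∈ S, v < 2 ^ b) {u v l m : ℕ}
    (huv : R u v) (hu : labAt R b T S (b * T) u = some l)
    (hv : labAt R b T S (b * T) v = some m) : l = m := by
  have key : ∀ i, Separated R i (labAt R b T S (i * T)) := by
    intro i
    induction i with
    | zero => intro u v l m _ _ _ j hj; omega
    | succ i ih =>
      rw [labAt_succ_mul]
      refine Separated.succ hR ?_ fun l => ?_
      · generalize labAt R b T S (i * T) = lab at ih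
        generalize T = t
        induction t with
        | zero => exact ih
        | succ t ih' => rw [Function.iterate_succ_apply']; exact ih'.step
      · have hsub := alive_labAt_subset (R := R) (b := b) (T := T) (S := S) (i * T)
        refine not_active_of_lt (hS.subset hsub) (lt_of_le_of_lt ?_ hT)
        exact Nat.mul_le_mul_left _ (Set.ncard_le_ncard hsub hS)
  refine Nat.eq_of_testBit_eq fun j => ?_
  rcases lt_or_ge j b with hj | hj
  · exact key b u v l m huv hu hv j hj
  -- Labels are elements of `S`, hence have no bits from position `b` on.
  · rw [Nat.testBit_lt_two_pow ((hb l (mem_of_labAt hu)).trans_le (Nat.pow_le_pow_right two_pos hj)),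
      Nat.testBit_lt_two_pow ((hb m (mem_of_labAt hv)).trans_le (Nat.pow_le_pow_right two_pos hj))]

end Clustering

/-! ### Radius of the clusters and locality of the clustering -/

namespace Clustering

open Net

variable {I : Type} {N M : Net I} {k ρ b i T : ℕ} {σ τ : ℕ → Option ℕ}

/-- Joining through a node within distance `k` adds at most `k` to the distance from the centre,
whose identifier is the label. The centre itself may have left the cluster. -/
theorem near_of_labAt {S : Set ℕ} {s v l : ℕ} (h : labAt (N.Near k) b T S s v = some l) :
    N.Near (s * k) v l := by
  induction s generalizing v with
  | zero =>
    simp only [labAt] at h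
    split_ifs at h
    cases h
    exact Near.refl _ _ _
  | succ s ih =>
    obtain ⟨m, hm, rfl | ⟨u, hu, hul⟩⟩ := exists_of_step_eq_some h
    · exact (ih hm).mono (Nat.mul_le_mul_right k (Nat.le_succ s))
    · exact (hu.trans (ih hul)).mono (by rw [Nat.succ_mul, Nat.add_comm])

theorem candidates_subset {v : ℕ} (h : Same N M k σ τ v) :
    candidates (N.Near k) i σ v ⊆ candidates (M.Near k) i τ v := by
  rintro l ⟨hl, u, hu, hul⟩
  exact ⟨hl, u, (h.1.near (s := 0) hu).1, by rw [← h.2 u hu, hul]⟩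

theorem request_congr {v : ℕ} (h : Same N M k σ τ v) :
    request (N.Near k) i σ v = request (M.Near k) i τ v := by
  have hc : candidates (N.Near k) i σ v = candidates (M.Near k) i τ v :=
    (candidates_subset h).antisymm (candidates_subset h.symm)
  unfold request IsRed
  rw [hc, h.2 v (Near.refl _ _ _)]

/-- Two members of a cluster are at most `2 * ρ` apart, so a view that reaches one member with `2 *
ρ` to spare contains them all. -/
theorem label_subset {r v l : ℕ} (h : Same N M (r + 2 * ρ) σ τ v)
    (hσ : ∀ u l, σ u = some l → N.Near ρ u l) (hl : ∃ w, N.Near r v w ∧ σ w = some l) :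
    {u | σ u = some l} ⊆ {u | τ u = some l} := by
  intro u hu
  obtain ⟨w, hw, hwl⟩ := hl
  have hnear : N.Near (r + 2 * ρ) v u :=
    (hw.trans ((hσ w l hwl).trans (hσ u l hu).symm)).mono (by omega)
  change τ u = some l
  rw [← h.2 u hnear]
  exact hu

theorem label_exists {r s v l : ℕ} (h : Same N M (r + s) σ τ v)
    (hl : ∃ w, N.Near r v w ∧ σ w = some l) : ∃ w, M.Near r v w ∧ τ w = some l := by
  obtain ⟨w, hw, hwl⟩ := hl
  exact ⟨w, (h.1.near hw).1, by rw [← h.2 w (hw.mono (Nat.le_add_right r s)), hwl]⟩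

theorem label_congr {r v l : ℕ} (h : Same N M (r + 2 * ρ) σ τ v)
    (hσ : ∀ u l, σ u = some l → N.Near ρ u l) (hτ : ∀ u l, τ u = some l → M.Near ρ u l)
    (hl : ∃ w, N.Near r v w ∧ σ w = some l) : {u | σ u = some l} = {u | τ u = some l} :=
  (label_subset h hσ hl).antisymm (label_subset h.symm hτ (label_exists h hl))

theorem request_subset {v l : ℕ} (h : Same N M (3 * k + 2 * ρ) σ τ v)
    (hσ : ∀ u l, σ u = some l → N.Near ρ u l) (hl : ∃ w, N.Near k v w ∧ σ w = some l) :
    {u | request (N.Near k) i σ u = some l} ⊆ {u | request (M.Near k) i τ u = some l} := by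
  intro u hu
  have hu : request (N.Near k) i σ u = some l := hu
  obtain ⟨w, hw, hwl⟩ := hl
  obtain ⟨-, -, w', hw', hwl'⟩ := request_eq_some hu
  have hnear : N.Near (2 * k + 2 * ρ) v u :=
    ((hw.trans ((hσ w l hwl).trans (hσ w' l hwl').symm)).trans hw'.symm).mono (by omega)
  have hs : Same N M k σ τ u := Same.near (h.mono (by omega)) hnear
  change request (M.Near k) i τ u = some l
  rw [← request_congr hs, hu]

/-- Radius: `k` to reach the cluster, `2 * ρ` to cross it, `k` to its requesters, and `k` to
determine their requests. -/
theorem step_congr {v : ℕ} (h : Same N M (3 * k + 2 * ρ) σ τ v)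
    (hσ : ∀ u l, σ u = some l → N.Near ρ u l) (hτ : ∀ u l, τ u = some l → M.Near ρ u l) :
    step (N.Near k) b i σ v = step (M.Near k) b i τ v := by
  have hr : request (N.Near k) i σ v = request (M.Near k) i τ v :=
    request_congr (h.mono (by omega))
  cases hv : request (N.Near k) i σ v with
  | none =>
    rw [step_of_request_none hv, step_of_request_none (hr ▸ hv), h.2 v (Near.refl _ _ _)]
  | some l =>
    have hl := (request_eq_some hv).2.2
    have h' : Same N M (k + 2 * ρ) σ τ v := h.mono (by omega)
    have hacc : Accepts (N.Near k) b i σ l ↔ Accepts (M.Near k) b i τ l := by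
      unfold Accepts
      rw [label_congr h' hσ hτ hl, (request_subset h hσ hl).antisymm
        (request_subset h.symm hτ (label_exists h' hl))]
    by_cases ha : Accepts (N.Near k) b i σ l
    · rw [step_of_accepts hv ha, step_of_accepts (hr ▸ hv) (hacc.1 ha)]
    · rw [step_of_not_accepts hv ha, step_of_not_accepts (hr ▸ hv) (mt hacc.2 ha)]

/-- The fixed bound `s₀` on the number of steps gives one cluster radius `s₀ * k` that is valid
throughout the induction. -/
theorem labAt_congr {S S' : Set ℕ} {s₀ s v : ℕ} (hs : s ≤ s₀)
    (h : Same N M (s * (3 * k + 2 * (s₀ * k))) (· ∈ S) (· ∈ S') v) :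
    labAt (N.Near k) b T S s v = labAt (M.Near k) b T S' s v := by
  induction s generalizing v with
  | zero =>
    have hiff : v ∈ S ↔ v ∈ S' := iff_of_eq (h.2 v (Near.refl _ _ _))
    by_cases hv : v ∈ S
    · simp [labAt, hv, hiff.1 hv]
    · simp [labAt, hv, mt hiff.2 hv]
  | succ s ih =>
    rw [Nat.succ_mul, Nat.add_comm] at h
    have hsk : s * k ≤ s₀ * k := Nat.mul_le_mul_right k (by omega)
    exact step_congr (ρ := s₀ * k) (h.map fun b hb => ih (by omega) hb)
      (fun u l hu => (near_of_labAt hu).mono hsk) (fun u l hu => (near_of_labAt hu).mono hsk)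

end Clustering

/-! ### Random tapes indexed by identifiers, and conditional expectations -/

open scoped ENNReal

instance : IsProbabilityMeasure tapeMeasure := by unfold tapeMeasure; infer_instance

instance (n : ℕ) : IsProbabilityMeasure (tapesMeasure n) := by unfold tapesMeasure; infer_instance

/-- The law of independent tapes, one for each identifier. -/
noncomputable def idMeasure : Measure (ℕ → RandomTape) := Measure.infinitePi fun _ => tapeMeasure

instance : IsProbabilityMeasure idMeasure := by unfold idMeasure; infer_instance

theorem map_comp_idMeasure {n : ℕ} {ident : Fin n → ℕ} (hid : Function.Injective ident) :
    idMeasure.map (fun ρ v => ρ (ident v)) = tapesMeasure n := by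
  refine (Measure.pi_eq fun s hs => ?_).symm
  rw [Measure.map_apply (by fun_prop) (MeasurableSet.univ_pi hs)]
  have h : (fun (ρ : ℕ → RandomTape) v => ρ (ident v)) ⁻¹' Set.univ.pi s =
      (↑(Finset.univ.image ident) : Set ℕ).pi (Function.extend ident s fun _ => Set.univ) := by
    ext ρ
    simp [Set.mem_pi, hid.extend_apply]
  rw [h, idMeasure, Measure.infinitePi_pi, Finset.prod_image (fun a _ b _ h => hid h)]
  · simp [hid.extend_apply]
  · intro a ha
    obtain ⟨v, -, rfl⟩ := Finset.mem_image.1 ha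
    rw [hid.extend_apply]
    exact hs v

/-- Take the tapes of the identifiers in `K` from `τ`, and the others from `ρ`. -/
noncomputable def mix (K : Set ℕ) (τ ρ : ℕ → RandomTape) : ℕ → RandomTape :=
  open Classical in fun a => if a ∈ K then τ a else ρ a

theorem measurable_mix (K : Set ℕ) :
    Measurable fun q : (ℕ → RandomTape) × (ℕ → RandomTape) => mix K q.1 q.2 := by
  refine measurable_pi_lambda _ fun a => ?_
  unfold mix
  split_ifs <;> fun_prop

/-- By independence the tapes in `K` may be drawn separately: a cylinder splits into its coordinates
in `K` and the others. -/
theorem map_mix_idMeasure (K : Set ℕ) :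
    (idMeasure.prod idMeasure).map (fun q => mix K q.1 q.2) = idMeasure := by
  classical
  refine Measure.eq_infinitePi _ fun s t ht => ?_
  rw [Measure.map_apply (measurable_mix K) (MeasurableSet.pi s.countable_toSet fun i _ => ht i)]
  have h : (fun q : (ℕ → RandomTape) × (ℕ → RandomTape) => mix K q.1 q.2) ⁻¹' (s : Set ℕ).pi t =
      (↑(s.filter (· ∈ K)) : Set ℕ).pi t ×ˢ (↑(s.filter (¬ · ∈ K)) : Set ℕ).pi t := by
    ext q
    simp only [Set.mem_preimage, Set.mem_pi, Set.mem_prod, Finset.coe_filter, Set.mem_ofPred_eq, mix,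
      Finset.mem_coe]
    constructor
    · intro h
      exact ⟨fun i hi => by simpa [hi.2] using h i hi.1, fun i hi => by simpa [hi.2] using h i hi.1⟩
    · intro h i hi
      by_cases hK : i ∈ K
      · simpa [hK] using h.1 i ⟨hi, hK⟩
      · simpa [hK] using h.2 i ⟨hi, hK⟩
  rw [h, Measure.prod_prod, idMeasure, Measure.infinitePi_pi _ fun i _ => ht i,
    Measure.infinitePi_pi _ fun i _ => ht i, Finset.prod_filter_mul_prod_filter_not]

theorem measurable_measure_mix {E : Set (ℕ → RandomTape)} (hE : MeasurableSet E) (K : Set ℕ) :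
    Measurable fun τ => idMeasure {ρ | mix K τ ρ ∈ E} :=
  measurable_measure_prodMk_left (measurable_mix K hE)

theorem lintegral_measure_mix {E : Set (ℕ → RandomTape)} (hE : MeasurableSet E) (K : Set ℕ) :
    ∫⁻ τ, idMeasure {ρ | mix K τ ρ ∈ E} ∂idMeasure = idMeasure E := by
  conv_rhs => rw [← map_mix_idMeasure K, Measure.map_apply (measurable_mix K) hE,
    Measure.prod_apply (measurable_mix K hE)]
  rfl

/-- Fill in the tapes that are not fixed in `f`. -/
def overlay (f : ℕ → Option RandomTape) (ρ : ℕ → RandomTape) : ℕ → RandomTape :=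
  fun a => (f a).getD (ρ a)

/-- Fix the tapes in `K` to be those of `τ`. -/
noncomputable def assign (f : ℕ → Option RandomTape) (K : Set ℕ) (τ : ℕ → RandomTape) :
    ℕ → Option RandomTape :=
  open Classical in fun a => if a ∈ K then some (τ a) else f a

/-- The conditional probability of the event `E`, given the tapes that are fixed in `f`. -/
noncomputable def condProb (E : (ℕ → RandomTape) → Prop) (f : ℕ → Option RandomTape) : ℝ≥0∞ :=
  idMeasure {ρ | E (overlay f ρ)}

theorem measurable_overlay (f : ℕ → Option RandomTape) : Measurable (overlay f) := by
  refine measurable_pi_lambda _ fun a => ?_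
  unfold overlay
  cases f a
  · exact measurable_pi_apply a
  · exact measurable_const

theorem condProb_eq_one {E : (ℕ → RandomTape) → Prop} {f : ℕ → Option RandomTape}
    (h : ∀ ρ, E (overlay f ρ)) : condProb E f = 1 := by
  simp [condProb, h]

theorem overlay_assign {f : ℕ → Option RandomTape} {K : Set ℕ} (hK : ∀ a ∈ K, f a = none)
    (τ ρ : ℕ → RandomTape) : overlay (assign f K τ) ρ = overlay f (mix K τ ρ) := by
  funext a
  by_cases ha : a ∈ K
  · simp [overlay, assign, mix, ha, hK a ha]
  · simp [overlay, assign, mix, ha]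

theorem condProb_assign {E : (ℕ → RandomTape) → Prop} {f : ℕ → Option RandomTape} {K : Set ℕ}
    (hK : ∀ a ∈ K, f a = none) (τ : ℕ → RandomTape) :
    condProb E (assign f K τ) = idMeasure {ρ | mix K τ ρ ∈ {ρ | E (overlay f ρ)}} := by
  simp only [condProb, overlay_assign hK, Set.mem_ofPred_eq]

/-- The method of conditional expectations: some assignment does not increase the expected number of
the events `E u`, `u ∈ U`, that occur. -/
theorem exists_assign_le {E : ℕ → (ℕ → RandomTape) → Prop} {U : Set ℕ}
    (hE : ∀ u ∈ U, MeasurableSet {ρ | E u ρ}) {f : ℕ → Option RandomTape} {K : Set ℕ}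
    (hK : ∀ a ∈ K, f a = none) :
    ∃ τ, ∑' u : U, condProb (E u) (assign f K τ) ≤ ∑' u : U, condProb (E u) f := by
  have hm : ∀ u : U, MeasurableSet {ρ | E u (overlay f ρ)} := fun u =>
    measurable_overlay f (hE u u.2)
  have hmeas : ∀ u : U, Measurable fun τ => condProb (E u) (assign f K τ) := fun u => by
    simp only [condProb_assign hK]
    exact measurable_measure_mix (hm u) K
  -- Some value of a function is at most its mean, and by Fubini the mean is the sum before `K` is
  -- fixed.
  obtain ⟨τ, hτ⟩ := exists_le_lintegral (μ := idMeasure)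
    (f := fun τ => ∑' u : U, condProb (E u) (assign f K τ)) (Measurable.tsum hmeas).aemeasurable
  refine ⟨τ, hτ.trans_eq ?_⟩
  rw [lintegral_tsum fun u => (hmeas u).aemeasurable]
  refine tsum_congr fun u => ?_
  simp only [condProb_assign hK]
  exact lintegral_measure_mix (hm u) K

/-! ### Fixing the tapes cluster by cluster -/

namespace Derandomization

open Net Clustering

variable {I : Type}

/-- The tapes `τ` for `K` do not increase the expected number of events `e u`, `u ∈ U`. -/
def IsGood (e : ℕ → (ℕ → RandomTape) → Prop) (U : Set ℕ) (f : ℕ → Option RandomTape) (K : Set ℕ)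
    (τ : ℕ → RandomTape) : Prop :=
  ∑' u : U, condProb (e u) (assign f K τ) ≤ ∑' u : U, condProb (e u) f

/-- The nodes at distance at most `s` from `K`. -/
def reach (N : Net I) (s : ℕ) (K : Set ℕ) : Set ℕ := {u | u ∈ N.node ∧ ∃ w ∈ K, N.Near s u w}

/-- A clustering of the nodes whose tapes are not yet fixed. -/
noncomputable def cluster (s b T : ℕ) (N : Net I) (f : ℕ → Option RandomTape) : ℕ → Option ℕ :=
  labAt (N.Near (2 * s)) b T {v | v ∈ N.node ∧ f v = none} (b * T)

variable (E : Net I → ℕ → (ℕ → RandomTape) → Prop) (s b T : ℕ)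

/-- Every cluster fixes its tapes. -/
noncomputable def fixStep (N : Net I) (f : ℕ → Option RandomTape) (v : ℕ) : Option RandomTape :=
  match cluster s b T N f v with
  | none => f v
  | some l => some (Classical.epsilon
      (IsGood (E N) (reach N s {u | cluster s b T N f u = some l}) f
        {u | cluster s b T N f u = some l}) v)

/-- The tapes that are fixed after `j` clusterings. -/
noncomputable def fixAt (N : Net I) : ℕ → ℕ → Option RandomTape
  | 0 => fun _ => none
  | j + 1 => fixStep E s b T N (fixAt N j)

/-- The radius of the view that determines one step of the derandomization. -/
def stepRadius (s b T : ℕ) : ℕ :=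
  2 * s + 2 * (b * T * (2 * s)) + b * T * (3 * (2 * s) + 2 * (b * T * (2 * s)))

variable {E s b T} {N M : Net I} {f g : ℕ → Option RandomTape}

theorem condProb_congr
    (hE : ∀ (N M : Net I) ρ ρ' a, Same N M s ρ ρ' a → E N a ρ = E M a ρ') {u : ℕ}
    (h : Same N M s f g u) : condProb (E N u) f = condProb (E M u) g := by
  unfold condProb
  congr 1
  ext ρ
  refine iff_of_eq (hE _ _ _ _ _ ⟨h.1, fun b hb => ?_⟩)
  simp only [overlay, h.2 b hb]

theorem cluster_congr {v : ℕ}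
    (h : Same N M (b * T * (3 * (2 * s) + 2 * (b * T * (2 * s)))) f g v) :
    cluster s b T N f v = cluster s b T M g v := by
  refine labAt_congr le_rfl ⟨h.1, fun c hc => ?_⟩
  have h1 := (h.1.near (s := 0) hc).2.base.1
  have h2 := h.2 c hc
  simp only [Set.mem_ofPred_eq, h1, h2]

theorem reach_subset {ρ v l : ℕ} {σ τ : ℕ → Option ℕ} {K : Set ℕ}
    (hK : K = {u | σ u = some l}) (hσ : ∀ u l, σ u = some l → N.Near ρ u l)
    (h : Same N M (2 * s + 2 * ρ) σ τ v) (hl : σ v = some l) :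
    reach N s K ⊆ reach M s K := by
  rintro u ⟨hu, w, hw, huw⟩
  have hwl : σ w = some l := by rw [hK] at hw; exact hw
  have hnear : N.Near (s + 2 * ρ) v u :=
    (((hσ v l hl).trans (hσ w l hwl).symm).trans huw.symm).mono (by omega)
  have ha : N.Agree M s u := (Agree.near (h.1.mono (by omega)) hnear).2
  exact ⟨ha.base.1.1 hu, w, hw, (Agree.near (s := 0) ha huw).1⟩

/-- The cluster of `v` lies within `2 * ρ`, where `ρ = b * T * (2 * s)`. The events near it lie
within a further `s` and depend on another `s`. The last summand of `stepRadius` determines the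
labels there. -/
theorem fixStep_congr
    (hE : ∀ (N M : Net I) ρ ρ' a, Same N M s ρ ρ' a → E N a ρ = E M a ρ') {v : ℕ}
    (h : Same N M (stepRadius s b T) f g v) : fixStep E s b T N f v = fixStep E s b T M g v := by
  have hlab : Same N M (2 * s + 2 * (b * T * (2 * s))) (cluster s b T N f) (cluster s b T M g) v :=
    h.map fun c hc => cluster_congr hc
  have hσ : ∀ u l, cluster s b T N f u = some l → N.Near (b * T * (2 * s)) u l :=
    fun u l hu => near_of_labAt hu
  have hτ : ∀ u l, cluster s b T M g u = some l → M.Near (b * T * (2 * s)) u l :=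
    fun u l hu => near_of_labAt hu
  have hv := hlab.2 v (Near.refl _ _ _)
  unfold fixStep
  rw [← hv]
  cases hl : cluster s b T N f v with
  | none => exact h.2 v (Near.refl _ _ _)
  | some l =>
    have hK : {u | cluster s b T N f u = some l} = {u | cluster s b T M g u = some l} :=
      label_congr (r := 0) (ρ := b * T * (2 * s)) (hlab.mono (by omega)) hσ hτ ⟨v, rfl, hl⟩
    have hreach := (reach_subset (s := s) rfl hσ hlab hl).antisymm
      (reach_subset hK hτ hlab.symm (hv ▸ hl))
    simp only
    rw [← hK, hreach]
    have hs : ∀ u ∈ reach M s {u | cluster s b T N f u = some l}, Same N M s f g u := by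
      rw [← hreach]
      rintro u ⟨-, w, hw, huw⟩
      have hnear : N.Near (s + 2 * (b * T * (2 * s))) v u :=
        (((hσ v l hl).trans (hσ w l hw).symm).trans huw.symm).mono (by omega)
      exact Same.near (h.mono (by unfold stepRadius; omega)) hnear
    -- The two `IsGood` predicates are equal, so `Classical.epsilon` makes the same choice. This
    -- also lets the members of one cluster agree without further communication.
    refine congrArg (fun p : (ℕ → RandomTape) → Prop => some (Classical.epsilon p v)) (funext fun τ => ?_)
    refine congr_arg₂ (· ≤ ·) (tsum_congr fun u => condProb_congr hE ⟨(hs u u.2).1, fun c hc => ?_⟩)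
      (tsum_congr fun u => condProb_congr hE (hs u u.2))
    rw [assign, assign, (hs u u.2).2 c hc]

theorem fixAt_congr
    (hE : ∀ (N M : Net I) ρ ρ' a, Same N M s ρ ρ' a → E N a ρ = E M a ρ') {j v : ℕ}
    (h : N.Agree M (j * stepRadius s b T) v) : fixAt E s b T N j v = fixAt E s b T M j v := by
  induction j generalizing v with
  | zero => rfl
  | succ j ih =>
    rw [Nat.succ_mul, Nat.add_comm] at h
    exact fixStep_congr hE ⟨h.mono (Nat.le_add_right _ _), fun c hc => ih (h.near hc).2⟩

theorem cluster_subset {v l : ℕ} (h : cluster s b T N f v = some l) : v ∈ N.node ∧ f v = none := by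
  have hv : v ∈ alive (cluster s b T N f) := by simp [alive, h]
  exact alive_labAt_subset _ hv

theorem fixStep_eq_none {v : ℕ} :
    fixStep E s b T N f v = none ↔ cluster s b T N f v = none ∧ f v = none := by
  unfold fixStep
  cases h : cluster s b T N f v <;> simp

theorem card_unfixed_step (hN : N.node.Finite) (hb : 0 < b) :
    2 * {v | v ∈ N.node ∧ fixStep E s b T N f v = none}.ncard ≤
      {v | v ∈ N.node ∧ f v = none}.ncard := by
  set S := {v | v ∈ N.node ∧ f v = none} with hS
  have hfin : S.Finite := hN.subset fun v hv => hv.1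
  have h1 : S.ncard ≤ 2 * (alive (cluster s b T N f)).ncard :=
    card_le_two_mul_card_alive hfin hb
  have hsub : alive (cluster s b T N f) ⊆ S := alive_labAt_subset _
  have h2 : {v | v ∈ N.node ∧ fixStep E s b T N f v = none} ⊆ S \ alive (cluster s b T N f) := by
    rintro v ⟨hv, hv'⟩
    rw [fixStep_eq_none] at hv'
    exact ⟨⟨hv, hv'.2⟩, fun h => h hv'.1⟩
  have h3 := Set.ncard_le_ncard h2 hfin.sdiff
  have h4 := Set.ncard_sdiff_add_ncard_of_subset hsub hfin
  omega

theorem card_unfixed (hN : N.node.Finite) (hb : 0 < b) (j : ℕ) :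
    2 ^ j * {v | v ∈ N.node ∧ fixAt E s b T N j v = none}.ncard ≤ N.node.ncard := by
  induction j with
  | zero => simp [fixAt]
  | succ j ih =>
    refine le_trans ?_ ih
    rw [pow_succ, mul_assoc]
    exact Nat.mul_le_mul_left _ (card_unfixed_step hN hb)

theorem exists_fixAt_eq_some (hN : N.node.Finite) (hb : 0 < b) {j : ℕ} (hj : N.node.ncard < 2 ^ j)
    {v : ℕ} (hv : v ∈ N.node) : fixAt E s b T N j v ≠ none := by
  intro h
  have h1 : 0 < {v | v ∈ N.node ∧ fixAt E s b T N j v = none}.ncard :=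
    (Set.ncard_pos (hN.subset fun v hv => hv.1)).2 ⟨v, hv, h⟩
  have h2 := card_unfixed (E := E) (s := s) (T := T) hN hb j
  nlinarith

theorem Near.mem_of_closed {U : Set ℕ} (hU : ∀ a c, N.adj a c → a ∈ U → c ∈ U) {r a c : ℕ}
    (h : N.Near r a c) (ha : a ∈ U) : c ∈ U := by
  induction r generalizing a with
  | zero => cases h; exact ha
  | succ r ih =>
    rcases h with h | ⟨w, hw, h⟩
    · exact ih h ha
    · exact ih h (hU a w hw ha)

/-- An event has at most one cluster within distance `s`. Grouped by that cluster, the sum splits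
into parts that are controlled by independent choices. -/
theorem sum_condProb_fixStep_le
    (hE : ∀ (N M : Net I) ρ ρ' a, Same N M s ρ ρ' a → E N a ρ = E M a ρ')
    (hN : N.node.Finite) (hT : (2 * b) ^ T * N.node.ncard < (2 * b + 1) ^ T)
    (hb : ∀ v ∈ N.node, v < 2 ^ b) (hmeas : ∀ u ∈ N.node, MeasurableSet {ρ | E N u ρ})
    {W : Finset ℕ} (hWN : ∀ u ∈ W, u ∈ N.node) (hW : ∀ a c, N.adj a c → a ∈ W → c ∈ W) :
    ∑ u ∈ W, condProb (E N u) (fixStep E s b T N f) ≤ ∑ u ∈ W, condProb (E N u) f := by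
  classical
  set lab := cluster s b T N f with hlab
  set S := {v | v ∈ N.node ∧ f v = none} with hS
  have hSsub : S ⊆ N.node := fun v hv => hv.1
  have huniq : ∀ {u w w' l m}, N.Near s u w → N.Near s u w' → lab w = some l → lab w' = some m →
      l = m := by
    intro u w w' l m hw hw' hl hm
    refine labAt_eq_of_rel (R := N.Near (2 * s)) (b := b) (T := T) (S := S) (fun _ _ h => h.symm)
      (hN.subset hSsub) (lt_of_le_of_lt ?_ hT) (fun v hv => hb v hv.1) ?_ hl hm
    · exact Nat.mul_le_mul_left _ (Set.ncard_le_ncard hSsub hN)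
    · exact (hw.symm.trans hw').mono (by omega)
  -- The cluster within distance `s` of `u`, if any; it is unique by `huniq`.
  let c : ℕ → Option ℕ := fun u =>
    if h : ∃ l, u ∈ reach N s {u | lab u = some l} then some h.choose else none
  have hc : ∀ u l, c u = some l ↔ u ∈ reach N s {u | lab u = some l} := by
    intro u l
    constructor
    · intro h
      simp only [c] at h
      split_ifs at h with hex
      cases h
      exact hex.choose_spec
    · intro h
      have hex : ∃ l, u ∈ reach N s {u | lab u = some l} := ⟨l, h⟩
      simp only [c, dif_pos hex, Option.some.injEq]
      obtain ⟨-, w, hw, huw⟩ := hex.choose_spec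
      obtain ⟨-, w', hw', huw'⟩ := h
      exact huniq huw huw' hw hw'
  rw [← Finset.sum_fiberwise_of_maps_to (fun u hu => Finset.mem_image_of_mem c hu)
      (fun u => condProb (E N u) (fixStep E s b T N f)),
    ← Finset.sum_fiberwise_of_maps_to (fun u hu => Finset.mem_image_of_mem c hu)
      (fun u => condProb (E N u) f)]
  refine Finset.sum_le_sum fun o ho => ?_
  cases o with
  | none =>
    refine le_of_eq (Finset.sum_congr rfl fun u hu => ?_)
    obtain ⟨huW, hcu⟩ := Finset.mem_filter.1 hu
    refine condProb_congr hE ⟨Agree.refl _ _ _, fun w hw => ?_⟩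
    have hnone : lab w = none := by
      by_contra hne
      obtain ⟨l, hl⟩ := Option.ne_none_iff_exists'.1 hne
      have := (hc u l).2 ⟨hWN u huW, w, hl, hw⟩
      rw [hcu] at this
      cases this
    rw [fixStep, ← hlab, hnone]
  | some l =>
    obtain ⟨u₀, hu₀, hcu₀⟩ := Finset.mem_image.1 ho
    set K := {u | lab u = some l} with hK
    have hlW : l ∈ W := by
      obtain ⟨-, w, hw, huw⟩ := (hc u₀ l).1 hcu₀
      exact Near.mem_of_closed (U := ↑W) hW (huw.trans (near_of_labAt hw)) hu₀
    -- The centre `l` is in `W`, and `W` is closed under adjacency. So the group is everything the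
    -- cluster optimizes for, not just a part of it.
    have hset : (↑(W.filter (c · = some l)) : Set ℕ) = reach N s K := by
      ext u
      simp only [Finset.coe_filter, Set.mem_ofPred_eq, hc]
      refine ⟨fun h => h.2, fun h => ⟨?_, h⟩⟩
      obtain ⟨-, w, hw, huw⟩ := h
      exact Near.mem_of_closed (U := ↑W) hW (huw.trans (near_of_labAt hw)).symm hlW
    set τ := Classical.epsilon (IsGood (E N) (reach N s K) f K) with hτ
    have hgood : IsGood (E N) (reach N s K) f K τ :=
      Classical.epsilon_spec (p := IsGood (E N) (reach N s K) f K)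
        (exists_assign_le (fun u hu => hmeas u hu.1) fun a ha => (cluster_subset ha).2)
    have hstep : ∀ u ∈ W.filter (c · = some l),
        condProb (E N u) (fixStep E s b T N f) = condProb (E N u) (assign f K τ) := by
      intro u hu
      obtain ⟨-, w', hw', huw'⟩ := (hc u l).1 (Finset.mem_filter.1 hu).2
      refine condProb_congr hE ⟨Agree.refl _ _ _, fun w hw => ?_⟩
      cases hlw : lab w with
      | none =>
        have hwK : w ∉ K := fun h => by
          rw [hK, Set.mem_ofPred_eq, hlw] at h
          cases h
        rw [fixStep, ← hlab, hlw, assign, if_neg hwK]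
      | some m =>
        cases huniq hw huw' hlw hw'
        rw [fixStep, ← hlab, hlw, assign, if_pos (show w ∈ K from hlw)]
    rw [Finset.sum_congr rfl hstep, ← Finset.tsum_subtype', ← Finset.tsum_subtype', hset]
    exact hgood

/-- If fewer than one of the events `E N u` is expected in a union of connected components, then none of
them occurs there with the tapes found by the derandomization. -/
theorem not_event_of_sum_lt_one
    (hE : ∀ (N M : Net I) ρ ρ' a, Same N M s ρ ρ' a → E N a ρ = E M a ρ')
    (hN : N.node.Finite) (hT : (2 * b) ^ T * N.node.ncard < (2 * b + 1) ^ T) (hb₀ : 0 < b)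
    (hb : ∀ v ∈ N.node, v < 2 ^ b) (hmeas : ∀ u ∈ N.node, MeasurableSet {ρ | E N u ρ})
    {W : Finset ℕ} (hWN : ∀ u ∈ W, u ∈ N.node) (hW : ∀ a c, N.adj a c → a ∈ W → c ∈ W)
    (hlt : ∑ u ∈ W, idMeasure {ρ | E N u ρ} < 1) {j : ℕ} (hj : N.node.ncard < 2 ^ j)
    (ρ : ℕ → RandomTape) {u : ℕ} (hu : u ∈ W) : ¬ E N u (overlay (fixAt E s b T N j) ρ) := by
  intro hEu
  have hle : ∀ i, ∑ u ∈ W, condProb (E N u) (fixAt E s b T N i) ≤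
      ∑ u ∈ W, idMeasure {ρ | E N u ρ} := by
    intro i
    induction i with
    | zero => exact le_rfl
    | succ i ih => exact (sum_condProb_fixStep_le hE hN hT hb hmeas hWN hW).trans ih
  -- All tapes that matter for `u` are fixed, so an event that occurs has conditional probability
  -- `1`.
  have h1 : condProb (E N u) (fixAt E s b T N j) = 1 := by
    refine condProb_eq_one fun ρ' => ?_
    rw [← hE N N (overlay (fixAt E s b T N j) ρ) _ u ⟨Agree.refl _ _ _, fun w hw => ?_⟩]
    · exact hEu
    · have hwN : w ∈ N.node := hWN w (Near.mem_of_closed (U := ↑W) hW hw hu)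
      obtain ⟨t, ht⟩ := Option.ne_none_iff_exists'.1
        (exists_fixAt_eq_some (E := E) (s := s) (T := T) hN hb₀ hj hwN)
      simp [overlay, ht]
  have h2 : condProb (E N u) (fixAt E s b T N j) ≤
      ∑ u ∈ W, condProb (E N u) (fixAt E s b T N j) :=
    Finset.single_le_sum (f := fun u => condProb (E N u) (fixAt E s b T N j))
      (fun _ _ => zero_le) hu
  rw [h1] at h2
  exact absurd (h2.trans (hle j)) (not_le.2 hlt)

end Derandomization

/-! ### Polylogarithmic bounds and the number of steps per phase -/

/-- The length of the binary expansion of a positive number. -/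
def bitLength (n : ℕ) : ℕ := Nat.log 2 n + 1

theorem lt_two_pow_bitLength (n : ℕ) : n < 2 ^ bitLength n := Nat.lt_pow_succ_log_self one_lt_two n

theorem two_le_bitLength {n : ℕ} (hn : 2 ≤ n) : 2 ≤ bitLength n :=
  Nat.succ_le_succ (Nat.log_pos one_lt_two hn)

/-- Polylogarithmic growth, in terms of natural numbers. -/
def IsPolylog (r : ℕ → ℕ) : Prop := ∃ k, ∀ n, 2 ≤ n → r n ≤ bitLength n ^ k

namespace IsPolylog

variable {r r' : ℕ → ℕ}

theorem const (m : ℕ) : IsPolylog fun _ => m :=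
  ⟨m, fun _ hn => (Nat.lt_two_pow_self (n := m)).le.trans (Nat.pow_le_pow_left (two_le_bitLength hn) m)⟩

theorem bitLength : IsPolylog bitLength := ⟨1, fun n _ => by rw [pow_one]⟩

theorem mul (h : IsPolylog r) (h' : IsPolylog r') : IsPolylog fun n => r n * r' n := by
  obtain ⟨k, hk⟩ := h
  obtain ⟨k', hk'⟩ := h'
  exact ⟨k + k', fun n hn => by rw [pow_add]; exact Nat.mul_le_mul (hk n hn) (hk' n hn)⟩

theorem add (h : IsPolylog r) (h' : IsPolylog r') : IsPolylog fun n => r n + r' n := by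
  obtain ⟨k, hk⟩ := h
  obtain ⟨k', hk'⟩ := h'
  refine ⟨k + k' + 1, fun n hn => ?_⟩
  have h2 := two_le_bitLength hn
  have h1 := (hk n hn).trans (Nat.pow_le_pow_right (by omega) (Nat.le_add_right k k'))
  have h1' := (hk' n hn).trans (Nat.pow_le_pow_right (by omega) (Nat.le_add_left k' k))
  rw [pow_succ]
  nlinarith

end IsPolylog

theorem LocalAlgorithm.IsPolylogTime.isPolylog {I O : Type} {A : LocalAlgorithm I O}
    (h : A.IsPolylogTime) : IsPolylog A.rounds := by
  obtain ⟨C, k, hC⟩ := h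
  obtain ⟨m, hm⟩ := exists_nat_ge C
  obtain ⟨j, hj⟩ := IsPolylog.const m
  refine ⟨j + k, fun n hn => ?_⟩
  have hn0 : (0 : ℝ) < n := by positivity
  have hlog : Real.log n ≤ bitLength n := by
    have h1 : (n : ℝ) ≤ 2 ^ bitLength n := by exact_mod_cast (lt_two_pow_bitLength n).le
    have h2 := Real.log_le_log hn0 h1
    rw [Real.log_pow] at h2
    have h3 : Real.log 2 ≤ 1 := Real.log_two_lt_d9.le.trans (by norm_num)
    nlinarith [(Nat.cast_nonneg (bitLength n) : (0 : ℝ) ≤ _)]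
  have hlog0 : 0 ≤ Real.log n := Real.log_natCast_nonneg n
  have h1 : (A.rounds n : ℝ) ≤ m * (bitLength n : ℝ) ^ k :=
    calc (A.rounds n : ℝ) ≤ C * Real.log n ^ k := hC n hn
      _ ≤ m * Real.log n ^ k := by gcongr
      _ ≤ _ := by gcongr
  have h2 : A.rounds n ≤ m * bitLength n ^ k := by exact_mod_cast h1
  rw [pow_add]
  exact h2.trans (Nat.mul_le_mul_right _ (hj n hn))

theorem LocalAlgorithm.isPolylogTime_of_isPolylog {I O : Type} {A : LocalAlgorithm I O}
    (h : IsPolylog A.rounds) : A.IsPolylogTime := by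
  obtain ⟨k, hk⟩ := h
  -- For `2 ≤ n` the bit length is at most twice the binary logarithm.
  refine ⟨(2 / Real.log 2) ^ k, k, fun n hn => ?_⟩
  have hl2 : 0 < Real.log 2 := Real.log_pos one_lt_two
  have h1 : (bitLength n : ℝ) ≤ 2 / Real.log 2 * Real.log n := by
    have h2 : ((2 : ℝ) ^ Nat.log 2 n) ≤ n := by exact_mod_cast Nat.pow_log_le_self 2 (by omega)
    have h3 := Real.log_le_log (by positivity) h2
    rw [Real.log_pow] at h3
    have h4 : (bitLength n : ℝ) ≤ 2 * Nat.log 2 n := by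
      have : 1 ≤ Nat.log 2 n := Nat.log_pos one_lt_two hn
      unfold bitLength
      exact_mod_cast (by omega : Nat.log 2 n + 1 ≤ 2 * Nat.log 2 n)
    rw [div_mul_eq_mul_div, le_div_iff₀ hl2]
    nlinarith
  calc (A.rounds n : ℝ) ≤ (bitLength n : ℝ) ^ k := by exact_mod_cast hk n hn
    _ ≤ (2 / Real.log 2 * Real.log n) ^ k := by gcongr
    _ = _ := mul_pow _ _ _

/-- Bernoulli's inequality for `(1 + 1 / m) ^ k`, with denominators cleared. -/
theorem pow_mul_add_le (m k : ℕ) : m ^ k * (m + k) ≤ (m + 1) ^ k * m := by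
  induction k with
  | zero => simp
  | succ k ih =>
    calc m ^ (k + 1) * (m + (k + 1)) = m ^ k * (m * (m + k + 1)) := by ring
      _ ≤ m ^ k * ((m + 1) * (m + k)) := Nat.mul_le_mul_left _ (by nlinarith)
      _ = (m + 1) * (m ^ k * (m + k)) := by ring
      _ ≤ (m + 1) * ((m + 1) ^ k * m) := Nat.mul_le_mul_left _ ih
      _ = _ := by ring

theorem two_mul_pow_self_le {m : ℕ} (hm : 0 < m) : 2 * m ^ m ≤ (m + 1) ^ m := by
  have h := pow_mul_add_le m m
  refine Nat.le_of_mul_le_mul_right (le_trans (le_of_eq ?_) h) hm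
  ring

/-- With `m = 2 * b`, growth by `1 + 1 / m` doubles every `m` steps, so `m * L` steps exceed any
size below `2 ^ L`. -/
theorem pow_mul_lt_succ_pow {m n L : ℕ} (hm : 0 < m) (hn : n < 2 ^ L) :
    m ^ (m * L) * n < (m + 1) ^ (m * L) := by
  have h0 : 0 < m ^ (m * L) := Nat.pow_pos hm
  calc m ^ (m * L) * n < m ^ (m * L) * 2 ^ L := Nat.mul_lt_mul_of_pos_left hn h0
    _ = (2 * m ^ m) ^ L := by rw [mul_pow, pow_mul, mul_comm]
    _ ≤ ((m + 1) ^ m) ^ L := Nat.pow_le_pow_left (two_mul_pow_self_le hm) L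
    _ = _ := (pow_mul _ _ _).symm

/-! ### Failure events and the derandomized algorithm -/

namespace Derandomization

open Net

variable {In Out : Type}

section Events

variable (A : LocalAlgorithm (In × RandomTape) Out) (B : LocalAlgorithm (In × Out) Bool) (n : ℕ)

/-- The node `u` rejects the output of `A` with the tapes `ρ`. -/
def Rejects (N : Net In) (u : ℕ) (ρ : ℕ → RandomTape) : Prop :=
  B.netRun n N (fun a => (N.inp a, A.netRun n N (fun a => (N.inp a, ρ a)) a)) u = false

/-- The node `u` rejects, and no neighbour with a smaller identifier does. -/
def Fails (N : Net In) (u : ℕ) (ρ : ℕ → RandomTape) : Prop :=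
  Rejects A B n N u ρ ∧ ∀ w, N.adj u w → w < u → ¬ Rejects A B n N w ρ

/-- The radius of the view that determines whether a node fails. -/
def failRadius : ℕ := B.rounds n + A.rounds n + 1

variable {A B n} {N M : Net In}

theorem netRun_inp_congr {X O : Type} (A : LocalAlgorithm (In × X) O) (n : ℕ) {ρ ρ' : ℕ → X} {u : ℕ}
    (h : Same N M (A.rounds n) ρ ρ' u) :
    A.netRun n N (fun a => (N.inp a, ρ a)) u = A.netRun n M (fun a => (M.inp a, ρ' a)) u :=
  A.netRun_congr n ⟨h.1, fun b hb => by
    beta_reduce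
    rw [h.2 b hb, (Agree.near (s := 0) h.1 hb).2.base.2]⟩

theorem rejects_congr {ρ ρ' : ℕ → RandomTape} {u : ℕ}
    (h : Same N M (B.rounds n + A.rounds n) ρ ρ' u) :
    Rejects A B n N u ρ = Rejects A B n M u ρ' := by
  unfold Rejects
  rw [netRun_inp_congr B n (h.map fun b hb => netRun_inp_congr A n hb)]

/-- The extra `1` in `failRadius` is for the verdicts of the neighbours. -/
theorem fails_congr (N M : Net In) (ρ ρ' : ℕ → RandomTape) (u : ℕ)
    (h : Same N M (failRadius A B n) ρ ρ' u) : Fails A B n N u ρ = Fails A B n M u ρ' := by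
  unfold failRadius at h
  unfold Fails
  rw [rejects_congr (h.mono (Nat.le_succ _))]
  refine congrArg _ (propext (forall_congr' fun w => ?_))
  refine ⟨fun hw haw => ?_, fun hw haw => ?_⟩
  · have haw' := (h.1.2.1 w).2 haw
    rw [← rejects_congr (Same.near (r := 1) (by rwa [Nat.add_comm]) (Near.of_adj haw'))]
    exact hw haw'
  · rw [rejects_congr (Same.near (r := 1) (by rwa [Nat.add_comm]) (Near.of_adj haw))]
    exact hw ((h.1.2.1 w).1 haw)

end Events

variable (A : LocalAlgorithm (In × RandomTape) Out) (B : LocalAlgorithm (In × Out) Bool) (c : ℕ)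

/-- The tapes that are found deterministically. -/
noncomputable def tapes (n : ℕ) (N : Net In) : ℕ → RandomTape :=
  overlay (fixAt (Fails A B n) (failRadius A B n) (c * bitLength n)
    (2 * (c * bitLength n) * bitLength n) N (bitLength n)) fun _ _ => false

/-- The number of rounds of the derandomized algorithm. -/
def totalRounds (n : ℕ) : ℕ :=
  A.rounds n + bitLength n * stepRadius (failRadius A B n) (c * bitLength n)
    (2 * (c * bitLength n) * bitLength n)

/-- The derandomized algorithm. -/
noncomputable def algorithm [Nonempty (Net In)] : LocalAlgorithm In Out :=
  LocalAlgorithm.ofLocal (totalRounds A B c)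
    fun n N => A.netRun n N fun a => (N.inp a, tapes A B c n N a)

variable {A B c}

theorem algorithm_run [Nonempty In] [Nonempty (Net In)] {n : ℕ} (G : SimpleGraph (Fin n))
    {ident : Fin n → ℕ} (hid : Function.Injective ident) (x : Fin n → In) :
    (algorithm A B c).run G ident x =
      A.run G ident fun u => (x u, tapes A B c n (ofGraph G ident x) (ident u)) := by
  funext v
  rw [algorithm, LocalAlgorithm.ofLocal_run _ _ _ G hid, LocalAlgorithm.netRun_ofGraph A G hid]
  · have hinp : ∀ u, (ofGraph G ident x).inp (ident u) = x u := fun u =>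
      hid.extend_apply x (fun _ => Classical.arbitrary In) u
    simp only [hinp]
  · intro N M a h
    refine netRun_inp_congr A n ⟨h.mono (Nat.le_add_right _ _), fun b hb => ?_⟩
    unfold tapes overlay
    rw [fixAt_congr fails_congr (h.near hb).2]

theorem isPolylog_totalRounds (hA : IsPolylog A.rounds) (hB : IsPolylog B.rounds) :
    IsPolylog (totalRounds A B c) := by
  have hL := IsPolylog.bitLength
  have hs : IsPolylog (failRadius A B) := (hB.add hA).add (IsPolylog.const 1)
  have hb : IsPolylog fun n => c * bitLength n := (IsPolylog.const c).mul hL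
  have hT : IsPolylog fun n => 2 * (c * bitLength n) * bitLength n :=
    ((IsPolylog.const 2).mul hb).mul hL
  have h2s : IsPolylog fun n => 2 * failRadius A B n := (IsPolylog.const 2).mul hs
  have hρ := (IsPolylog.const 2).mul ((hb.mul hT).mul h2s)
  exact hA.add (hL.mul ((h2s.add hρ).add ((hb.mul hT).mul (((IsPolylog.const 3).mul h2s).add hρ))))

end Derandomization

/-! ### The expected number of failures and correctness -/

namespace Derandomization

open Net

variable {In Out : Type} {A : LocalAlgorithm (In × RandomTape) Out}
  {B : LocalAlgorithm (In × Out) Bool} {c n : ℕ}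

/-- The node `v` rejects the output labelling `y`, and no neighbour with a smaller identifier does. -/
def FailsOn (B : LocalAlgorithm (In × Out) Bool) (G : SimpleGraph (Fin n)) (ident : Fin n → ℕ)
    (x : Fin n → In) (v : Fin n) (y : Fin n → Out) : Prop :=
  B.run G ident (fun u => (x u, y u)) v = false ∧ ∀ w, G.Adj v w → ident w < ident v →
    ¬ B.run G ident (fun u => (x u, y u)) w = false

variable {G : SimpleGraph (Fin n)} {ident : Fin n → ℕ} {x : Fin n → In}

theorem rejects_ofGraph [Nonempty In] (hid : Function.Injective ident) (v : Fin n)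
    (ρ : ℕ → RandomTape) :
    Rejects A B n (ofGraph G ident x) (ident v) ρ ↔
      B.run G ident (fun u => (x u, A.run G ident (fun u => (x u, ρ (ident u))) u)) v = false := by
  have hinp : ∀ u, (ofGraph G ident x).inp (ident u) = x u := fun u =>
    hid.extend_apply x (fun _ => Classical.arbitrary In) u
  unfold Rejects
  rw [LocalAlgorithm.netRun_ofGraph B G hid]
  simp only [hinp, LocalAlgorithm.netRun_ofGraph A G hid]

theorem fails_ofGraph [Nonempty In] (hid : Function.Injective ident) (v : Fin n)
    (ρ : ℕ → RandomTape) :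
    Fails A B n (ofGraph G ident x) (ident v) ρ ↔
      FailsOn B G ident x v (A.run G ident fun u => (x u, ρ (ident u))) := by
  unfold Fails FailsOn
  rw [rejects_ofGraph hid]
  refine and_congr_right fun _ => ⟨fun h w hw hlt => ?_, ?_⟩
  · rw [← rejects_ofGraph hid]
    exact h (ident w) ⟨v, w, hw, rfl, rfl⟩ hlt
  · rintro h _ ⟨v', w, hw, hv, rfl⟩ hlt
    cases hid hv
    rw [rejects_ofGraph hid]
    exact h w hw hlt

/-- There are only countably many output labellings, since `Out` is countable. -/
theorem measurableSet_run [Countable Out]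
    (hmeas : ∀ (v : Fin n) (o : Out),
      MeasurableSet {ρ : Fin n → RandomTape | A.run G ident (fun u => (x u, ρ u)) v = o})
    (Q : (Fin n → Out) → Prop) :
    MeasurableSet {ρ : Fin n → RandomTape | Q (A.run G ident fun u => (x u, ρ u))} := by
  have h : {ρ : Fin n → RandomTape | Q (A.run G ident fun u => (x u, ρ u))} =
      ⋃ y ∈ {y | Q y}, ⋂ v, {ρ | A.run G ident (fun u => (x u, ρ u)) v = y v} := by
    ext ρ
    simp only [Set.mem_ofPred_eq, Set.mem_iUnion, Set.mem_iInter, exists_prop]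
    constructor
    · exact fun hQ => ⟨_, hQ, fun _ => rfl⟩
    · rintro ⟨y, hy, hv⟩
      rwa [funext hv]
  rw [h]
  exact MeasurableSet.biUnion (Set.to_countable _) fun y _ => MeasurableSet.iInter fun v => hmeas v _

/-- In a connected component some node does not fail, unless there are nodes outside of it. -/
theorem exists_not_failsOn (hid : Function.Injective ident) (hn : 2 ≤ n) (v : Fin n)
    (y : Fin n → Out) : ∃ u, ¬ (G.Reachable v u ∧ FailsOn B G ident x u y) := by
  by_contra! hall
  have : Nontrivial (Fin n) := Fin.nontrivial_iff_two_le.2 hn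
  obtain ⟨w, hw⟩ := exists_ne v
  obtain ⟨p⟩ := (hall w).1
  cases p with
  | nil => exact hw rfl
  -- Both ends of the first edge of the path would reject, which the end with the larger identifier
  -- does not allow.
  | @cons _ u _ h _ =>
    rcases lt_trichotomy (ident v) (ident u) with hlt | heq | hlt
    · exact (hall u).2.2 v h.symm hlt (hall v).2.1
    · exact h.ne (hid heq)
    · exact (hall v).2.2 u h hlt (hall u).2.1

theorem exists_failsOn {y : Fin n → Out}
    (h : ¬ ∀ v, B.run G ident (fun u => (x u, y u)) v = true) : ∃ v, FailsOn B G ident x v y := by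
  have hne : ∃ v, B.run G ident (fun u => (x u, y u)) v = false := by simpa using h
  obtain ⟨v, hv, hmin⟩ := Set.exists_min_image
    {v | B.run G ident (fun u => (x u, y u)) v = false} ident (Set.toFinite _) hne
  exact ⟨v, hv, fun w _ hlt hw => not_le.2 hlt (hmin w hw)⟩

/-- No node fails on success. Otherwise, with probability at most `1 / n`, at most `n - 1` nodes of
`W` fail. -/
theorem sum_measure_lt_one [Countable Out] [Nonempty In] (hid : Function.Injective ident) (hn : 2 ≤ n)
    (hmeas : ∀ (v : Fin n) (o : Out),
      MeasurableSet {ρ : Fin n → RandomTape | A.run G ident (fun u => (x u, ρ u)) v = o})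
    (hprob : 1 - 1 / (n : ℝ) ≤ (tapesMeasure n).real {ρ : Fin n → RandomTape | ∀ v,
      B.run G ident (fun u => (x u, A.run G ident (fun u => (x u, ρ u)) u)) v = true})
    (v : Fin n) {W : Finset (Fin n)} (hW : ∀ u ∈ W, G.Reachable v u) :
    ∑ u ∈ W, tapesMeasure n {ρ | FailsOn B G ident x u (A.run G ident fun u => (x u, ρ u))} < 1 := by
  classical
  set y : (Fin n → RandomTape) → Fin n → Out := fun ρ => A.run G ident fun u => (x u, ρ u) with hy
  set S : Set (Fin n → RandomTape) :=
    {ρ | ∀ v, B.run G ident (fun u => (x u, y ρ u)) v = true} with hS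
  have hSm : MeasurableSet S :=
    measurableSet_run hmeas fun y => ∀ v, B.run G ident (fun u => (x u, y u)) v = true
  have hFm : ∀ u, MeasurableSet {ρ | FailsOn B G ident x u (y ρ)} := fun u =>
    measurableSet_run hmeas (FailsOn B G ident x u)
  have hcompl : tapesMeasure n Sᶜ ≤ ENNReal.ofReal (1 / n) := by
    rw [ENNReal.le_ofReal_iff_toReal_le (measure_ne_top _ _) (by positivity)]
    change (tapesMeasure n).real Sᶜ ≤ _
    rw [probReal_compl_eq_one_sub hSm]
    linarith
  have hpoint : ∀ ρ, ∑ u ∈ W, ({ρ | FailsOn B G ident x u (y ρ)}.indicator 1 ρ : ℝ≥0∞) ≤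
      Sᶜ.indicator (fun _ => ((n - 1 : ℕ) : ℝ≥0∞)) ρ := by
    intro ρ
    by_cases hρ : ρ ∈ S
    · rw [Set.indicator_of_notMem (by simpa using hρ)]
      refine le_of_eq (Finset.sum_eq_zero fun u _ => Set.indicator_of_notMem (fun h => ?_) _)
      have h1 := h.1
      rw [hρ u] at h1
      cases h1
    · rw [Set.indicator_of_mem hρ]
      obtain ⟨u₀, hu₀⟩ := exists_not_failsOn (B := B) (G := G) (x := x) hid hn v (y ρ)
      have hcard : (W.filter fun u => FailsOn B G ident x u (y ρ)).card < n := by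
        have := Finset.card_lt_univ_of_notMem
          (s := W.filter fun u => FailsOn B G ident x u (y ρ)) (x := u₀) fun h =>
            hu₀ ⟨hW _ (Finset.mem_filter.1 h).1, (Finset.mem_filter.1 h).2⟩
        simpa using this
      simp only [Set.indicator_apply, Set.mem_ofPred_eq, Pi.one_apply, Finset.sum_boole]
      exact_mod_cast Nat.le_sub_one_of_lt hcard
  calc ∑ u ∈ W, tapesMeasure n {ρ | FailsOn B G ident x u (y ρ)}
      = ∑ u ∈ W, ∫⁻ ρ, {ρ | FailsOn B G ident x u (y ρ)}.indicator 1 ρ ∂tapesMeasure n :=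
        Finset.sum_congr rfl fun u _ => (lintegral_indicator_one (hFm u)).symm
    _ = ∫⁻ ρ, ∑ u ∈ W, {ρ | FailsOn B G ident x u (y ρ)}.indicator 1 ρ ∂tapesMeasure n :=
        (lintegral_finsetSum W fun u _ => measurable_one.indicator (hFm u)).symm
    _ ≤ ∫⁻ ρ, Sᶜ.indicator (fun _ => ((n - 1 : ℕ) : ℝ≥0∞)) ρ ∂tapesMeasure n :=
        lintegral_mono hpoint
    _ = ((n - 1 : ℕ) : ℝ≥0∞) * tapesMeasure n Sᶜ := lintegral_indicator_const hSm.compl _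
    _ ≤ ((n - 1 : ℕ) : ℝ≥0∞) * ENNReal.ofReal (1 / n) := by gcongr
    _ < 1 := by
        rw [← ENNReal.ofReal_natCast, ← ENNReal.ofReal_mul (Nat.cast_nonneg _),
          ENNReal.ofReal_lt_one, mul_one_div, div_lt_one (by positivity)]
        exact_mod_cast Nat.sub_lt (by omega) one_pos

theorem solves [Countable Out] [Nonempty In] [Nonempty (Net In)] (hc : 1 ≤ c)
    {P : GraphProblem In Out}
    (hB : ∀ (n : ℕ) (G : SimpleGraph (Fin n)) (x : Fin n → In), 2 ≤ n → P.IsInstance G x →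
      ∀ ident : Fin n → ℕ, IsIdentAssignment c ident → ∀ y : Fin n → Out,
        P.IsSolution G x y ↔ ∀ v, B.run G ident (fun u => (x u, y u)) v = true)
    (hA : A.SolvesWithHighProbability c P) : (algorithm A B c).Solves c P := by
  classical
  intro n G x hn hinst ident hident
  have hid := hident.1
  obtain ⟨hmeas, hprob⟩ := hA n G x hn hinst ident hident
  simp only [hB n G x hn hinst ident hident] at hprob
  rw [hB n G x hn hinst ident hident, algorithm_run G hid]
  by_contra hrej
  obtain ⟨v, hv⟩ := exists_failsOn hrej
  set N := ofGraph G ident x with hN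
  have hcard : N.node.ncard = n := by
    change (Set.range ident).ncard = n
    rw [← Set.image_univ, Set.ncard_image_of_injective _ hid, Set.ncard_univ, Nat.card_fin]
  have hbit := two_le_bitLength hn
  have hb₀ : 0 < c * bitLength n := Nat.mul_pos hc (by omega)
  -- The component of a failing node `v`: closed under adjacency, as the derandomization requires,
  -- and connected, as the strict bound requires.
  set U : Finset (Fin n) := Finset.univ.filter fun u => G.Reachable v u with hU
  refine not_event_of_sum_lt_one (E := Fails A B n) (s := failRadius A B n) (b := c * bitLength n)
    (T := 2 * (c * bitLength n) * bitLength n) (N := N) (W := U.image ident) (j := bitLength n)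
    (u := ident v) fails_congr (Set.finite_range ident) ?_ hb₀ ?_ ?_ ?_ ?_ ?_ ?_
    (fun _ _ => false) ?_ ?_
  · rw [hcard]
    exact pow_mul_lt_succ_pow (by omega) (lt_two_pow_bitLength n)
  · rintro _ ⟨u, rfl⟩
    refine (hident.2 u).trans_le ?_
    rw [mul_comm, pow_mul]
    exact Nat.pow_le_pow_left (lt_two_pow_bitLength n).le c
  · rintro _ ⟨u, rfl⟩
    simp only [hN, fails_ofGraph hid]
    exact (measurableSet_run hmeas (FailsOn B G ident x u)).preimage
      (f := fun (ρ : ℕ → RandomTape) v => ρ (ident v)) (by fun_prop)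
  · intro u hu
    obtain ⟨u, -, rfl⟩ := Finset.mem_image.1 hu
    exact ⟨u, rfl⟩
  · rintro _ _ ⟨a, d, had, rfl, rfl⟩ ha
    obtain ⟨a', ha', heq⟩ := Finset.mem_image.1 ha
    cases hid heq
    exact Finset.mem_image_of_mem _ (Finset.mem_filter.2
      ⟨Finset.mem_univ _, (Finset.mem_filter.1 ha').2.trans had.reachable⟩)
  · rw [Finset.sum_image fun a _ b _ h => hid h]
    refine lt_of_eq_of_lt (Finset.sum_congr rfl fun u _ => ?_)
      (sum_measure_lt_one hid hn hmeas hprob v (W := U) fun u hu => (Finset.mem_filter.1 hu).2)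
    rw [← map_comp_idMeasure hid, Measure.map_apply (by fun_prop)
      (measurableSet_run hmeas (FailsOn B G ident x u))]
    simp only [hN, fails_ofGraph hid]
    rfl
  · rw [hcard]
    exact lt_two_pow_bitLength n
  · exact Finset.mem_image_of_mem _ (Finset.mem_filter.2 ⟨Finset.mem_univ _, .refl _⟩)
  · exact (fails_ofGraph hid v _).2 hv

end Derandomization

/-! ### The easy inclusion and the conclusion -/

/-- A deterministic algorithm, viewed as a randomized one. -/
def LocalAlgorithm.ignoreTapes {In Out : Type} (A : LocalAlgorithm In Out) :
    LocalAlgorithm (In × RandomTape) Out where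
  State := A.State
  Msg := A.Msg
  rounds := A.rounds
  init n a x := A.init n a x.1
  send := A.send
  receive := A.receive
  output := A.output

theorem LocalAlgorithm.ignoreTapes_run {In Out : Type} (A : LocalAlgorithm In Out) {n : ℕ}
    (G : SimpleGraph (Fin n)) (ident : Fin n → ℕ) (x : Fin n → In) (ρ : Fin n → RandomTape) :
    A.ignoreTapes.run G ident (fun u => (x u, ρ u)) = A.run G ident x := by
  have h : ∀ t, A.ignoreTapes.stateAfter G ident (fun u => (x u, ρ u)) t =
      A.stateAfter G ident x t := by
    intro t
    induction t with
    | zero => rfl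
    | succ t ih =>
      funext v
      simp only [stateAfter, ih]
      rfl
  funext v
  simp only [run]
  rw [show A.ignoreTapes.rounds n = A.rounds n from rfl, h]
  rfl

theorem LocalAlgorithm.Solves.ignoreTapes {In Out : Type} {A : LocalAlgorithm In Out} {c : ℕ}
    {P : GraphProblem In Out} (h : A.Solves c P) : A.ignoreTapes.SolvesWithHighProbability c P := by
  intro n G x hn hinst ident hident
  simp only [ignoreTapes_run]
  refine ⟨fun v o => MeasurableSet.const _, ?_⟩
  have hsol := h n G x hn hinst ident hident
  simp [hsol]

/-- The algorithm on networks whose nodes cannot have inputs. -/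
def LocalAlgorithm.ofIsEmpty (In Out : Type) [IsEmpty In] : LocalAlgorithm In Out where
  State := In
  Msg := Unit
  rounds _ := 0
  init _ _ x := x
  send _ _ := ()
  receive s _ := s
  output s := isEmptyElim s

end LocalModel

theorem theorem1p1 (In Out : Type) [Countable Out] (c : ℕ) (hc : 1 ≤ c) :
    LocalModel.PLOCAL In Out c = LocalModel.PRLOCAL In Out c := by
  ext P
  refine and_congr_right fun hP => ⟨?_, ?_⟩
  · rintro ⟨A, hA, hsol⟩
    exact ⟨A.ignoreTapes, hA, hsol.ignoreTapes⟩
  · rintro ⟨A, hA, hsol⟩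
    obtain ⟨B, hB, hcheck⟩ := hP
    rcases isEmpty_or_nonempty In with hIn | hIn
    · refine ⟨LocalModel.LocalAlgorithm.ofIsEmpty In Out,
        LocalModel.LocalAlgorithm.isPolylogTime_of_isPolylog (LocalModel.IsPolylog.const 0),
        fun n G x hn => ?_⟩
      -- Since `2 ≤ n` there is a node, and its input would be an element of the empty type.
      exact isEmptyElim (x ⟨0, by omega⟩)
    · have : Nonempty (LocalModel.Net In) :=
        ⟨⟨∅, fun _ _ => False, fun h => h, fun _ => Classical.arbitrary In⟩⟩
      exact ⟨LocalModel.Derandomization.algorithm A B c,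
        LocalModel.LocalAlgorithm.isPolylogTime_of_isPolylog
        (LocalModel.Derandomization.isPolylog_totalRounds hA.isPolylog hB.isPolylog),
        LocalModel.Derandomization.solves hc hcheck hsol⟩
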